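/- Let $a,b\in\mathbb R$ and $\sigma,P,\gamma>0$. Consider the Gaussian relay channel in which the relay receives $y_r=a\,x_s+w_r$ and the destination receives $y_d=x_s+b\,x_r+w_d$, where $w_r,w_d$ are independent white Gaussian noises of variance $\sigma^2$, independent of $x_s$. Over a block of $n$ symbols the input is $x_s\sim\mathcal N(0,\Sigma_n)$, where $\Sigma_n=[r_{i-j}]_{i,j=1}^n$ is a Toeplitz section of the autocovariance sequence $(r_k)_{k\in\mathbb Z}$ of a stationary process, and the relay sends $x_r=H_n y_r$ with $H_n=[h_{i-j}]_{i,j=1}^n$ for a stable, possibly noncausal impulse response $(h_j)_{j\in\mathbb Z}$, $\sum_j|h_j|<\infty$. The power constraints are $\operatorname{tr}\Sigma_n\le nP$ and $\mathbb E\|x_r\|^2=\operatorname{tr}\bigl(H_n(a^2\Sigma_n+\sigma^2 I)H_n^H\bigr)\le n\gamma P$. Let $$C_n=\sup_{\Sigma_n,H_n}\frac1n I(x_s;y_d),$$ where the mutual information $I$ is in nats; here $$\frac1n I(x_s;y_d)=\frac1{2n}\log\frac{\bigl|(I+abH_n)\Sigma_n(I+abH_n)^H+\sigma^2(I+b^2H_nH_n^H)\bigr|}{\bigl|\sigma^2(I+b^2H_nH_n^H)\bigr|}.$$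 Then the limit $C_{LTI}(P,\gamma P)=\lim_{n\to\infty}C_n$ exists and, with $\mathcal C(x)=\frac12\log(1+x)$, $$C_{LTI}(P,\gamma P)=\max_{\tau,\theta,\bar\lambda}\ \tau_0\,\mathcal C\!\left(\frac{\theta_0P}{\tau_0\sigma^2}\right)+\sum_{j=1}^{49}\tau_j\,\mathcal C\!\left(\frac{\theta_j}{\tau_j}\cdot\frac{P}{\sigma^2}\cdot\frac{|1+ab\bar\lambda_j|^2}{1+b^2|\bar\lambda_j|^2}\right),$$ where the maximum is attained and is taken over $\tau,\theta\in\mathbb R^{50}$ and $\bar\lambda\in\mathbb C^{49}$ subject to $\tau_j,\theta_j\ge0$, $\sum_{j=0}^{49}\tau_j=1$, $\sum_{j=0}^{49}\theta_j=1$ and the relay power constraint $$\sum_{j=1}^{49}\tau_j|\bar\lambda_j|^2\left(\frac{a^2\theta_jP}{\tau_j}+\sigma^2\right)\le\gamma P .$$ (Terms with $\tau_j=0$ are read by continuity: $\tau_j\,\mathcal C(\cdot/\tau_j)=0$ and $\tau_j\cdot\theta_j/\tau_j=\theta_j$.) The supremum of the same objective under the relay power constraint with equality, $=\gamma P$, is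 also $C_{LTI}(P,\gamma P)$. The same limit is obtained when the taps $h_j$ and the autocovariance $r_k$ may be complex ($\Sigma_n$ Hermitian), the rate and the two powers being given by the displayed determinant and trace formulas. -/

import Mathlib

open MeasureTheory ProbabilityTheory Filter Topology
open scoped ENNReal ComplexOrder

noncomputable section

namespace LTIRelay

/-- The `n × n` Toeplitz matrix with entries `c (i - j)`. -/
def toeplitz {R : Type*} (c : ℤ → R) (n : ℕ) : Matrix (Fin n) (Fin n) R :=
  Matrix.of fun i j => c ((i : ℤ) - (j : ℤ))

/-- Stability of a (possibly noncausal) impulse response: absolute summability. -/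
def IsStable {R : Type*} [Norm R] (h : ℤ → R) : Prop :=
  Summable fun j => ‖h j‖

/-- `r` is the autocovariance sequence of a stationary process: all its Toeplitz sections
are Hermitian positive semidefinite. -/
def IsAutocovariance {R : Type*} [Ring R] [PartialOrder R] [StarRing R] (r : ℤ → R) : Prop :=
  ∀ n : ℕ, (toeplitz r n).PosSemidef

/-- Real signal blocks of length `n`, with the Euclidean norm. -/
abbrev Block (n : ℕ) : Type := EuclideanSpace ℝ (Fin n)

/-- Joint law of the independent triple `(x_s, w_r, w_d)` over one block:
`x_s ∼ N(0, S)`, `w_r ∼ N(0, σ² I)`, `w_d ∼ N(0, σ² I)`. -/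
def blockLaw {n : ℕ} (σ : ℝ) (S : Matrix (Fin n) (Fin n) ℝ) :
    Measure (Block n × Block n × Block n) :=
  (multivariateGaussian 0 S).prod
    ((multivariateGaussian 0 (σ ^ 2 • (1 : Matrix (Fin n) (Fin n) ℝ))).prod
      (multivariateGaussian 0 (σ ^ 2 • (1 : Matrix (Fin n) (Fin n) ℝ))))

/-- The source block `x_s`. -/
def sourceSent {n : ℕ} (ω : Block n × Block n × Block n) : Block n := ω.1

/-- The block received by the relay, `y_r = a x_s + w_r`. -/
def relayReceived {n : ℕ} (a : ℝ) (ω : Block n × Block n × Block n) : Block n :=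
  a • sourceSent ω + ω.2.1

/-- The block sent by the relay, `x_r = H y_r`. -/
def relaySent {n : ℕ} (a : ℝ) (H : Matrix (Fin n) (Fin n) ℝ)
    (ω : Block n × Block n × Block n) : Block n :=
  Matrix.toEuclideanCLM (𝕜 := ℝ) H (relayReceived a ω)

/-- The block received by the destination, `y_d = x_s + b x_r + w_d`. -/
def destReceived {n : ℕ} (a b : ℝ) (H : Matrix (Fin n) (Fin n) ℝ)
    (ω : Block n × Block n × Block n) : Block n :=
  sourceSent ω + b • relaySent a H ω + ω.2.2

/-- Mutual information (in nats) of two random variables: the Kullback-Leibler divergence of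
their joint law from the product of their laws. -/
def mutualInfo {Ω X Y : Type*} [MeasurableSpace Ω] [MeasurableSpace X] [MeasurableSpace Y]
    (μ : Measure Ω) (f : Ω → X) (g : Ω → Y) : ℝ≥0∞ :=
  InformationTheory.klDiv (μ.map fun ω => (f ω, g ω)) ((μ.map f).prod (μ.map g))

/-- The relay filter `h` and the input autocovariance `r` may be used at block length `n`:
the filter is stable, the input is stationary, the source power is at most `P` per symbol and
the expected relay power is at most `γ P` per symbol. -/
structure IsAdmissible (a σ P γ : ℝ) (n : ℕ) (h r : ℤ → ℝ) : Prop where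
  stable : IsStable h
  stationary : IsAutocovariance r
  source_power : (toeplitz r n).trace ≤ n * P
  relay_power :
    ∫ ω, ‖relaySent a (toeplitz h n) ω‖ ^ 2 ∂(blockLaw σ (toeplitz r n)) ≤ n * (γ * P)

/-- The maximum rate at block length `n`: the supremum of `I(x_s; y_d) / n`. -/
def blockCapacity (a b σ P γ : ℝ) (n : ℕ) : ℝ≥0∞ :=
  ⨆ (h : ℤ → ℝ) (r : ℤ → ℝ) (_ : IsAdmissible a σ P γ n h r),
    mutualInfo (blockLaw σ (toeplitz r n)) sourceSent (destReceived a b (toeplitz h n)) / n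

/-- The rate `(1 / 2n) log (|A S Aᴴ + N| / |N|)` with `A = I + a b H`,
`N = σ² (I + b² H Hᴴ)`, for a complex relay matrix `H` and a complex covariance `S`. -/
def logDetRate {n : ℕ} (a b σ : ℝ) (H S : Matrix (Fin n) (Fin n) ℂ) : ℝ :=
  let A : Matrix (Fin n) (Fin n) ℂ := 1 + ((a * b : ℝ) : ℂ) • H
  let N : Matrix (Fin n) (Fin n) ℂ :=
    ((σ ^ 2 : ℝ) : ℂ) • (1 + ((b ^ 2 : ℝ) : ℂ) • (H * H.conjTranspose))
  1 / (2 * n) * Real.log ((A * S * A.conjTranspose + N).det.re / N.det.re)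

/-- The admissibility conditions, with both powers as traces, for complex filter taps and a
complex autocovariance. -/
structure IsAdmissibleComplex (a σ P γ : ℝ) (n : ℕ) (h r : ℤ → ℂ) : Prop where
  stable : IsStable h
  stationary : IsAutocovariance r
  source_power : (toeplitz r n).trace.re ≤ n * P
  relay_power :
    (toeplitz h n * (((a ^ 2 : ℝ) : ℂ) • toeplitz r n + ((σ ^ 2 : ℝ) : ℂ) • 1) *
      (toeplitz h n).conjTranspose).trace.re ≤ n * (γ * P)

/-- The maximum of the log-determinant rate at block length `n` when the filter taps and the
autocovariance may be complex. -/
def blockCapacityComplex (a b σ P γ : ℝ) (n : ℕ) : ℝ≥0∞ :=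
  ⨆ (h : ℤ → ℂ) (r : ℤ → ℂ) (_ : IsAdmissibleComplex a σ P γ n h r),
    ENNReal.ofReal (logDetRate a b σ (toeplitz h n) (toeplitz r n))

/-- `𝒞(x) = ½ log (1 + x)`. -/
def gaussCap (x : ℝ) : ℝ := 1 / 2 * Real.log (1 + x)

/-- A choice of one mode without relay transmission (index `0`) and `m` modes with relay gains:
band fractions `τ`, source power fractions `θ`, complex gains `gain`. -/
structure Modes (m : ℕ) where
  τ : Fin (m + 1) → ℝ
  θ : Fin (m + 1) → ℝ
  gain : Fin m → ℂ

namespace Modes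

variable {m : ℕ}

/-- Nonnegative band fractions and nonnegative power fractions, each with sum one. -/
structure IsValid (q : Modes m) : Prop where
  τ_nonneg : ∀ j, 0 ≤ q.τ j
  θ_nonneg : ∀ j, 0 ≤ q.θ j
  sum_τ : ∑ j, q.τ j = 1
  sum_θ : ∑ j, q.θ j = 1

/-- The relay power `∑ τ_j |λ_j|² (a² θ_j P / τ_j + σ²)`, with `τ_j` multiplied out. -/
def relayPower (a σ P : ℝ) (q : Modes m) : ℝ :=
  ∑ j : Fin m, ‖q.gain j‖ ^ 2 * (a ^ 2 * q.θ j.succ * P + q.τ j.succ * σ ^ 2)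

/-- The rate of a choice of modes. A mode with `τ_j = 0` contributes `0`, the limit of its
term as `τ_j → 0`. -/
def rate (a b σ P : ℝ) (q : Modes m) : ℝ :=
  q.τ 0 * gaussCap (q.θ 0 * P / (q.τ 0 * σ ^ 2)) +
    ∑ j : Fin m, q.τ j.succ * gaussCap (q.θ j.succ / q.τ j.succ * (P / σ ^ 2) *
      (‖1 + (a : ℂ) * b * q.gain j‖ ^ 2 / (1 + b ^ 2 * ‖q.gain j‖ ^ 2)))

end Modes

end LTIRelay

end

/-! A single mode is a scalar relay channel with input power x and gain z; it yields a triple (rate,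
source power, relay power) in `modeTriples`. A choice of modes shares the band between such
channels, so the optimal value C is the largest rate in the convex hull of these triples under the
two power budgets.

Converse. Hahn-Banach separation gives multipliers μ > 0, ν ≥ 0 with a Lagrangian bound by C for
every scalar mode (`exists_multipliers`). `log_det_ratio_le_of_scalar_bound` carries it to an
arbitrary complex relay matrix H, which need be neither normal nor Toeplitz. Order the right
singular vectors of H by decreasing squared singular value g_i, and rescale each input direction by
its Lagrangian price μ + ν a² g_i. On vectors supported on the indices from k on, the resulting
channel form is at most κ_k, the efficiency of the best scalar gain not exceeding √g_k: AM-GM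
separates the direct path from the relay path, and Bessel's inequality decouples the relay modes
(`two_mul_re_dotProduct_le`). By Courant-Fischer the k-th eigenvalue is at most κ_k, and Hadamard's
inequality leaves n scalar channels, each covered by the scalar bound. Hence the rate is at most C
at every block length, for complex taps as well.

Achievability. An n-periodic sequence has circulant n × n sections, diagonalised by the Fourier
matrix; even Fourier coefficients make it real. Assigning modes symmetrically to frequencies
realises every choice of real-gain modes up to rounding of the band fractions
(`exists_tendsto_le_blockCapacity`), and the perspective τ 𝒞(x/τ) is continuous up to τ = 0. Real
gains are enough, since aligning phases and cutting gains at |a|/|b| loses nothing; this also makes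
the search compact, so the maximum is attained.

Number of modes. The triples live in ℝ³, so by Carathéodory four modes carry any point of the hull.
A further mode stays free, and in a vanishing band it can spend exactly the leftover relay power,
which gives the version with equality. -/

noncomputable section

namespace LTIRelay

/-! ### The scalar problem: the best relay gain below a cap. -/

/-- The point `l ∈ [0, D]` at which `(1 + c l)² / ((1 + B l²) (μ + η l²))` is maximal on `[0, D]`,
described by the sign of the derivative. -/
lemma exists_stationary_gain {c B μ η D : ℝ} (hc : 0 ≤ c) (hμ : 0 < μ) (hD : 0 ≤ D) :
    ∃ l : ℝ, 0 ≤ l ∧ l ≤ D ∧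
      0 ≤ c * μ - (B * μ + η) * l - 2 * B * η * l ^ 3 - c * η * B * l ^ 4 ∧
      (l = D ∨ c * μ - (B * μ + η) * l - 2 * B * η * l ^ 3 - c * η * B * l ^ 4 = 0) := by
  -- `f l` is the numerator of half the logarithmic derivative of the ratio, over the common
  -- denominator (1 + c l)(1 + B l²)(μ + η l²).
  set f : ℝ → ℝ := fun l => c * μ - (B * μ + η) * l - 2 * B * η * l ^ 3 - c * η * B * l ^ 4
  rcases le_or_gt 0 (f D) with h | h
  · exact ⟨D, hD, le_rfl, h, Or.inl rfl⟩
  · have hcont : ContinuousOn f (Set.Icc 0 D) := by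
      apply Continuous.continuousOn; fun_prop
    have h0 : (0 : ℝ) ∈ Set.Icc (f D) (f 0) := by
      refine ⟨h.le, ?_⟩
      simp only [f]; ring_nf; positivity
    obtain ⟨l, hl, hl0⟩ := intermediate_value_Icc' hD hcont h0
    exact ⟨l, hl.1, hl.2, hl0.ge, Or.inr hl0⟩

/-- A decoupled quadratic bound for all modes with relay gain at most `D`, tight at the best
gain `l ≤ D`. -/
lemma exists_gain_bound {c B μ η D : ℝ} (hc : 0 ≤ c) (hB : 0 ≤ B) (hμ : 0 < μ) (hη : 0 ≤ η)
    (hD : 0 ≤ D) :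
    ∃ l ρ κ : ℝ, 0 ≤ l ∧ l ≤ D ∧ 1 ≤ ρ ∧ κ * (μ + η * l ^ 2) = (1 + c * l) ^ 2 / (1 + B * l ^ 2) ∧
      ∀ t, 0 ≤ t → t ≤ D ^ 2 → ρ ≤ κ * (μ + η * t) ∧
        c ^ 2 * t ≤ (κ * (μ + η * t) - ρ) * (1 - 1 / ρ + B * t) := by
  obtain ⟨l, hl0, hlD, hΨ, hcase⟩ := exists_stationary_gain (B := B) (η := η) hc hμ hD
  have h1 : 0 < 1 + c * l := by positivity
  have h2 : 0 < 1 + B * l ^ 2 := by positivity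
  have h3 : 0 < μ + η * l ^ 2 := by positivity
  have hpos1 : 0 ≤ 2 * B * η * l ^ 3 := by positivity
  have hpos2 : 0 ≤ c * η * B * l ^ 4 := by positivity
  have hpos3 : 0 ≤ B * μ * l := by positivity
  have hpos4 : 0 ≤ η * l := by positivity
  have hcB : 0 ≤ c - B * l := by
    have : 0 ≤ μ * (c - B * l) := by nlinarith
    exact nonneg_of_mul_nonneg_right this hμ
  have hcη : 0 ≤ c * μ - η * l := by nlinarith
  -- In the scalar channel of gain l the optimal test vector is w = ρ y, so splitting the direct
  -- path with weight ρ loses nothing at t = l². κ is the value of the ratio at l.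
  set ρ := (1 + c * l) / (1 + B * l ^ 2) with hρ
  set κ := ρ * (1 + c * l) / (μ + η * l ^ 2) with hκ
  have hρ1 : 1 ≤ ρ := by
    rw [hρ, le_div_iff₀ h2]; nlinarith
  have hρ0 : 0 < ρ := by linarith
  have hκ0 : 0 ≤ κ := by positivity
  refine ⟨l, ρ, κ, hl0, hlD, hρ1, ?_, ?_⟩
  · rw [hκ, hρ]; field_simp
  · intro t ht0 htD
    have hX0 : ρ ≤ κ * μ := by
      have : κ * μ - ρ = ρ * (l * (c * μ - η * l)) / (μ + η * l ^ 2) := by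
        rw [hκ]; field_simp; ring
      have h4 : 0 ≤ ρ * (l * (c * μ - η * l)) / (μ + η * l ^ 2) := by positivity
      linarith
    have hX : ρ ≤ κ * (μ + η * t) := by nlinarith [mul_nonneg hκ0 (mul_nonneg hη ht0)]
    refine ⟨hX, ?_⟩
    set w := ρ / ((μ + η * l ^ 2) * (1 + c * l)) with hw
    have hw0 : 0 ≤ w := by positivity
    -- The difference is quadratic in t with root t = l². The cofactor is w c times the stationarity
    -- polynomial plus κ η B (l² - t). At the cap, t ≤ l² makes both factors nonnegative; at a
    -- stationary point a square remains.
    have hid : (κ * (μ + η * t) - ρ) * (1 - 1 / ρ + B * t) - c ^ 2 * t =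
        (l ^ 2 - t) * (w * ((c * μ - η * l) * (c - B * l)) - κ * η * B * t) := by
      rw [hw, hκ, hρ]; field_simp; ring
    have hid2 : w * ((c * μ - η * l) * (c - B * l)) - κ * η * B * l ^ 2 = w * (c *
        (c * μ - (B * μ + η) * l - 2 * B * η * l ^ 3 - c * η * B * l ^ 4)) := by
      rw [hw, hκ]; field_simp; ring
    rw [← sub_nonneg, hid]
    have hsplit : w * ((c * μ - η * l) * (c - B * l)) - κ * η * B * t =
        w * (c * (c * μ - (B * μ + η) * l - 2 * B * η * l ^ 3 - c * η * B * l ^ 4)) +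
          κ * η * B * (l ^ 2 - t) := by rw [← hid2]; ring
    rw [hsplit]
    have hnn : 0 ≤ κ * η * B := by positivity
    rcases hcase with rfl | h0
    · have h5 : 0 ≤ l ^ 2 - t := by linarith
      positivity
    · rw [h0, mul_zero, mul_zero, zero_add]
      have : (l ^ 2 - t) * (κ * η * B * (l ^ 2 - t)) = κ * η * B * (l ^ 2 - t) ^ 2 := by ring
      rw [this]; positivity

/-! ### Eigenvalue, determinant and quadratic-form bounds for complex matrices. -/

section

open Matrix

lemma star_dotProduct_self_eq {ι : Type*} [Fintype ι] (x : ι → ℂ) :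
    star x ⬝ᵥ x = ((∑ i, ‖x i‖ ^ 2 : ℝ) : ℂ) := by
  simp only [dotProduct, Pi.star_apply, RCLike.star_def, Complex.conj_mul']
  push_cast; rfl

/-- Spectral decomposition of a Hermitian matrix with the eigenvalues in decreasing order. -/
lemma exists_antitone_spectral {n : ℕ} {G : Matrix (Fin n) (Fin n) ℂ} (hG : G.IsHermitian) :
    ∃ (V : Matrix (Fin n) (Fin n) ℂ) (g : Fin n → ℝ), Vᴴ * V = 1 ∧ V * Vᴴ = 1 ∧ Antitone g ∧
      G = V * diagonal (fun i => (g i : ℂ)) * Vᴴ := by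
  set e : Fin n ≃ Fin n := (finCongr (Fintype.card_fin n).symm).trans
    (Fintype.equivOfCardEq (Fintype.card_fin _)) with he
  set U : Matrix (Fin n) (Fin n) ℂ := hG.eigenvectorUnitary.1
  have hU1 : Uᴴ * U = 1 := (Matrix.mem_unitaryGroup_iff'.1 hG.eigenvectorUnitary.2)
  have hU2 : U * Uᴴ = 1 := (Matrix.mem_unitaryGroup_iff.1 hG.eigenvectorUnitary.2)
  refine ⟨U.submatrix id e, hG.eigenvalues ∘ e, ?_, ?_, ?_, ?_⟩
  · rw [conjTranspose_submatrix, ← submatrix_mul _ _ _ _ _ Function.bijective_id, hU1]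
    simp
  · rw [conjTranspose_submatrix, ← submatrix_mul _ _ _ _ _ e.bijective, hU2]
    simp
  · intro i j hij
    simp only [Function.comp_apply, IsHermitian.eigenvalues, he, Equiv.trans_apply,
      Equiv.symm_apply_apply]
    exact hG.eigenvalues₀_antitone (by simpa using hij)
  · have h := hG.spectral_theorem
    rw [Unitary.conjStarAlgAut_apply] at h
    have h2 : (diagonal fun i => (((hG.eigenvalues ∘ e) i : ℝ) : ℂ)) =
        (diagonal (RCLike.ofReal ∘ hG.eigenvalues) : Matrix (Fin n) (Fin n) ℂ).submatrix e e := by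
      rw [submatrix_diagonal_equiv]; rfl
    rw [h2, conjTranspose_submatrix, ← submatrix_mul _ _ _ _ _ e.bijective,
      ← submatrix_mul _ _ _ _ _ e.bijective]
    simpa using! h

/-- If the quadratic form of `Q diag(lam) Qᴴ` is at most `κ k` on unit vectors supported on
`[k, n)`, then `lam k ≤ κ k`. -/
lemma eigenvalue_le_of_flag_bound {n : ℕ} {Q : Matrix (Fin n) (Fin n) ℂ} {lam : Fin n → ℝ}
    (hQ : Q * Qᴴ = 1) (hlam : Antitone lam) (k : Fin n) {κ : ℝ}
    (h : ∀ x : Fin n → ℂ, (∀ i, i < k → x i = 0) →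
      (star x ⬝ᵥ ((Q * diagonal (fun i => (lam i : ℂ)) * Qᴴ) *ᵥ x)).re ≤ κ * ∑ i, ‖x i‖ ^ 2) :
    lam k ≤ κ := by
  -- Courant-Fischer by counting: T x = 0 asks that x vanish below k and Qᴴ x above k. The zero row
  -- k leaves n - 1 conditions, so a nonzero solution exists.
  set T : Matrix (Fin n) (Fin n) ℂ := Matrix.of fun i j =>
    if i < k then (1 : Matrix (Fin n) (Fin n) ℂ) i j else if i = k then 0 else Qᴴ i j with hT
  have hdet : T.det = 0 := det_eq_zero_of_row_eq_zero k (fun j => by simp [hT])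
  obtain ⟨x, hx0, hx⟩ := Matrix.exists_mulVec_eq_zero_iff.2 hdet
  have h1 : ∀ i, i < k → x i = 0 := by
    intro i hi
    have := congrFun hx i
    simpa [mulVec, dotProduct, hT, hi, Matrix.one_apply] using this
  have h2 : ∀ i, k < i → (Qᴴ *ᵥ x) i = 0 := by
    intro i hi
    have := congrFun hx i
    simpa [mulVec, dotProduct, hT, hi.not_gt, hi.ne'] using this
  have hq := h x h1
  set y := Qᴴ *ᵥ x with hy
  have hxy : star x ⬝ᵥ ((Q * diagonal (fun i => (lam i : ℂ)) * Qᴴ) *ᵥ x) =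
      ((∑ i, lam i * ‖y i‖ ^ 2 : ℝ) : ℂ) := by
    rw [← mulVec_mulVec, ← mulVec_mulVec, dotProduct_mulVec, ← hy]
    have : star x ᵥ* Q = star y := by rw [hy, star_mulVec, conjTranspose_conjTranspose]
    rw [this]
    simp only [dotProduct, mulVec_diagonal, Pi.star_apply, RCLike.star_def]
    push_cast
    refine Finset.sum_congr rfl fun i _ => ?_
    rw [← Complex.conj_mul']; ring
  have hnorm : ∑ i, ‖y i‖ ^ 2 = ∑ i, ‖x i‖ ^ 2 := by
    have h3 : star y ⬝ᵥ y = star x ⬝ᵥ x := by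
      rw [hy, star_mulVec, conjTranspose_conjTranspose, ← dotProduct_mulVec, mulVec_mulVec, hQ,
        one_mulVec]
    rw [star_dotProduct_self_eq, star_dotProduct_self_eq] at h3
    exact_mod_cast h3
  rw [hxy, Complex.ofReal_re] at hq
  have hpos : 0 < ∑ i, ‖x i‖ ^ 2 := by
    obtain ⟨i, hi⟩ := Function.ne_iff.1 hx0
    exact Finset.sum_pos' (fun i _ => by positivity) ⟨i, Finset.mem_univ _, by
      have : x i ≠ 0 := hi
      positivity⟩
  have hlow : lam k * ∑ i, ‖x i‖ ^ 2 ≤ ∑ i, lam i * ‖y i‖ ^ 2 := by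
    rw [← hnorm, Finset.mul_sum]
    refine Finset.sum_le_sum fun i _ => ?_
    rcases le_or_gt i k with hik | hik
    · exact mul_le_mul_of_nonneg_right (hlam hik) (by positivity)
    · simp [h2 i hik]
  exact le_of_mul_le_mul_right (hlow.trans hq) hpos

/-- Apply log t ≤ t - 1 to each eigenvalue. Once the diagonal is scaled to ones the right side is
zero, which is Hadamard's inequality. -/
lemma log_det_le_trace_sub {n : ℕ} {X : Matrix (Fin n) (Fin n) ℂ} (hX : X.PosDef) :
    Real.log X.det.re ≤ X.trace.re - n := by
  have h1 : X.det.re = ∏ i, hX.1.eigenvalues i := by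
    rw [hX.1.det_eq_prod_eigenvalues]
    rw [← Complex.ofReal_re (∏ i, hX.1.eigenvalues i)]; push_cast; rfl
  have h2 : X.trace.re = ∑ i, hX.1.eigenvalues i := by
    rw [hX.1.trace_eq_sum_eigenvalues]
    rw [← Complex.ofReal_re (∑ i, hX.1.eigenvalues i)]; push_cast; rfl
  rw [h1, h2, Real.log_prod (fun i _ => (hX.eigenvalues_pos i).ne')]
  calc ∑ i, Real.log (hX.1.eigenvalues i) ≤ ∑ i, (hX.1.eigenvalues i - 1) :=
        Finset.sum_le_sum fun i _ => Real.log_le_sub_one_of_pos (hX.eigenvalues_pos i)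
    _ = _ := by simp

/-- Hadamard's inequality in logarithmic form. -/
lemma log_det_le_sum_log_diag {n : ℕ} {X : Matrix (Fin n) (Fin n) ℂ} (hX : X.PosDef) :
    Real.log X.det.re ≤ ∑ i, Real.log (X i i).re := by
  have hd : ∀ i, 0 < (X i i).re := fun i => (Complex.pos_iff.1 (hX.diag_pos (i := i))).1
  have hd' : ∀ i, X i i = ((X i i).re : ℂ) := fun i =>
    Complex.ext rfl (by simpa using (Complex.pos_iff.1 (hX.diag_pos (i := i))).2.symm)
  set s : Fin n → ℝ := fun i => (√(X i i).re)⁻¹ with hs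
  have hs0 : ∀ i, 0 < s i := fun i => inv_pos.2 (Real.sqrt_pos.2 (hd i))
  set R : Matrix (Fin n) (Fin n) ℂ := diagonal fun i => (s i : ℂ) with hR
  have hRH : Rᴴ = R := by
    rw [hR, diagonal_conjTranspose]; congr 1; ext i; simp
  have hRinj : Function.Injective R.mulVec := by
    intro x y hxy
    ext i
    have := congrFun hxy i
    simp only [hR, mulVec_diagonal] at this
    exact mul_left_cancel₀ (by exact_mod_cast (hs0 i).ne') this
  have hY : (R * X * R).PosDef := by
    have := hX.conjTranspose_mul_mul_same hRinj
    rwa [hRH] at this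
  have h := log_det_le_trace_sub hY
  have htr : (R * X * R).trace.re = n := by
    have : ∀ i, (R * X * R) i i = 1 := by
      intro i
      rw [hR, mul_diagonal, diagonal_mul, hd' i]
      have : s i * (X i i).re * s i = 1 := by
        have h1 : (X i i).re = √(X i i).re * √(X i i).re := (Real.mul_self_sqrt (hd i).le).symm
        have h2 : √(X i i).re ≠ 0 := (Real.sqrt_pos.2 (hd i)).ne'
        rw [hs]; simp only; nth_rewrite 2 [h1]; field_simp
      exact_mod_cast this
    simp [Matrix.trace, this]
  have hdet : (R * X * R).det.re = (∏ i, s i ^ 2) * X.det.re := by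
    have : (R * X * R).det = ((∏ i, s i ^ 2 : ℝ) : ℂ) * X.det := by
      rw [det_mul, det_mul, hR, det_diagonal]; push_cast
      rw [Finset.prod_pow]; ring
    rw [this, Complex.re_ofReal_mul]
  have hdetX : 0 < X.det.re := (Complex.pos_iff.1 hX.det_pos).1
  have hprod : 0 < ∏ i, s i ^ 2 := Finset.prod_pos fun i _ => pow_pos (hs0 i) 2
  rw [htr, hdet, sub_self, Real.log_mul hprod.ne' hdetX.ne',
    Real.log_prod (fun i _ => (pow_pos (hs0 i) 2).ne')] at h
  have : ∀ i, Real.log (s i ^ 2) = - Real.log (X i i).re := by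
    intro i
    rw [hs]; simp only
    rw [inv_pow, Real.sq_sqrt (hd i).le, Real.log_inv]
  simp only [this, Finset.sum_neg_distrib] at h
  linarith

/-- Water-filling bound: the information `log det (1 + S E)` is at most that of parallel channels
whose gains dominate the quadratic form of `E` along the coordinate flag. -/
lemma log_det_one_add_mul_le {n : ℕ} {S E : Matrix (Fin n) (Fin n) ℂ} (hS : S.PosSemidef)
    (hE : E.PosSemidef) {κ : Fin n → ℝ}
    (h : ∀ k, ∀ x : Fin n → ℂ, (∀ i, i < k → x i = 0) →
      (star x ⬝ᵥ (E *ᵥ x)).re ≤ κ k * ∑ i, ‖x i‖ ^ 2) :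
    ∃ s : Fin n → ℝ, (∀ k, 0 ≤ s k) ∧ ∑ k, s k = S.trace.re ∧
      Real.log (1 + S * E).det.re ≤ ∑ k, Real.log (1 + κ k * s k) := by
  obtain ⟨Q, lam, hQ1, hQ2, hlam, hEQ⟩ := exists_antitone_spectral hE.1
  have hle : ∀ k, lam k ≤ κ k := fun k =>
    eigenvalue_le_of_flag_bound hQ2 hlam k (by rw [← hEQ]; exact h k)
  have hdiag : diagonal (fun i => (lam i : ℂ)) = Qᴴ * E * Q := by
    rw [hEQ]
    calc diagonal (fun i => (lam i : ℂ)) = (Qᴴ * Q) * diagonal (fun i => (lam i : ℂ)) * (Qᴴ * Q) := by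
          rw [hQ1, one_mul, mul_one]
      _ = _ := by simp only [Matrix.mul_assoc]
  have hlam0 : ∀ k, 0 ≤ lam k := by
    intro k
    have := (hE.conjTranspose_mul_mul_same Q).diag_nonneg (i := k)
    rw [← hdiag, diagonal_apply_eq] at this
    exact_mod_cast this
  -- In the eigenbasis of E the determinant is that of 1 + √Λ W √Λ, with Λ the diagonal of
  -- eigenvalues. Hadamard keeps only the diagonal of W, which has the trace of S and serves as the
  -- powers s.
  set W := Qᴴ * S * Q with hW
  have hWpsd : W.PosSemidef := hS.conjTranspose_mul_mul_same Q
  set R : Matrix (Fin n) (Fin n) ℂ := diagonal fun i => (√(lam i) : ℂ) with hR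
  have hRH : Rᴴ = R := by
    rw [hR, diagonal_conjTranspose]; congr 1; ext i; simp
  have hRR : R * R = diagonal (fun i => (lam i : ℂ)) := by
    rw [hR, diagonal_mul_diagonal]; congr 1; ext i
    exact_mod_cast Real.mul_self_sqrt (hlam0 i)
  have hdet : (1 + S * E).det = (1 + R * W * R).det := by
    calc (1 + S * E).det = (1 + (S * Q * R) * (R * Qᴴ)).det := by
          rw [hEQ, ← hRR]; simp only [Matrix.mul_assoc]
      _ = (1 + (R * Qᴴ) * (S * Q * R)).det := det_one_add_mul_comm _ _
      _ = _ := by rw [hW]; simp only [Matrix.mul_assoc]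
  have hX : (1 + R * W * R).PosDef := by
    have := hWpsd.conjTranspose_mul_mul_same R
    rw [hRH] at this
    exact PosDef.one.add_posSemidef this
  refine ⟨fun k => (W k k).re, fun k => (Complex.nonneg_iff.1 (hWpsd.diag_nonneg (i := k))).1,
    ?_, ?_⟩
  · have : W.trace = S.trace := by
      rw [hW, Matrix.trace_mul_cycle, hQ2, one_mul]
    rw [← this, Matrix.trace, Complex.re_sum]; rfl
  · rw [hdet]
    refine (log_det_le_sum_log_diag hX).trans (Finset.sum_le_sum fun k _ => ?_)
    have hw : 0 ≤ (W k k).re := (Complex.nonneg_iff.1 (hWpsd.diag_nonneg (i := k))).1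
    have hent : ((1 + R * W * R) k k).re = 1 + lam k * (W k k).re := by
      rw [Matrix.add_apply, one_apply_eq, hR, mul_diagonal, diagonal_mul]
      have : (√(lam k) : ℂ) * W k k * (√(lam k) : ℂ) = ((lam k : ℝ) : ℂ) * W k k := by
        rw [mul_right_comm]
        congr 1
        exact_mod_cast Real.mul_self_sqrt (hlam0 k)
      rw [this, Complex.add_re, Complex.one_re, Complex.re_ofReal_mul]
    rw [hent]
    have := mul_nonneg (hlam0 k) hw
    exact Real.log_le_log (by linarith)
      (by linarith [mul_le_mul_of_nonneg_right (hle k) hw])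

/-- Bessel's inequality for the orthogonal columns of `B`. -/
lemma sum_sq_div_le_of_orthogonal {n : ℕ} {B : Matrix (Fin n) (Fin n) ℂ} {g : Fin n → ℝ}
    (hB : Bᴴ * B = diagonal fun i => (g i : ℂ)) (w : Fin n → ℂ) :
    ∑ i, ‖(Bᴴ *ᵥ w) i‖ ^ 2 / g i ≤ ∑ i, ‖w i‖ ^ 2 := by
  set ω := Bᴴ *ᵥ w with hω
  -- B v is the projection of w onto the column span, and the claim is ‖w - B v‖² ≥ 0. If g i = 0,
  -- column i vanishes and division by zero drops its term.
  set v : Fin n → ℂ := fun i => ω i / g i with hv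
  have h1 : star (B *ᵥ v) ⬝ᵥ w = ((∑ i, ‖ω i‖ ^ 2 / g i : ℝ) : ℂ) := by
    rw [star_mulVec, ← dotProduct_mulVec, ← hω]
    simp only [dotProduct, Pi.star_apply, RCLike.star_def, hv, map_div₀, Complex.conj_ofReal]
    push_cast
    refine Finset.sum_congr rfl fun i _ => ?_
    rw [← Complex.conj_mul']; ring
  have h2 : star (B *ᵥ v) ⬝ᵥ (B *ᵥ v) = ((∑ i, ‖ω i‖ ^ 2 / g i : ℝ) : ℂ) := by
    rw [star_mulVec, ← dotProduct_mulVec, mulVec_mulVec, hB]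
    simp only [dotProduct, Pi.star_apply, RCLike.star_def, hv, map_div₀, Complex.conj_ofReal,
      mulVec_diagonal]
    push_cast
    refine Finset.sum_congr rfl fun i _ => ?_
    rw [← Complex.conj_mul']
    rcases eq_or_ne (g i) 0 with h0 | h0
    · simp [h0]
    · have : (g i : ℂ) ≠ 0 := by exact_mod_cast h0
      field_simp
  have h3 : star w ⬝ᵥ (B *ᵥ v) = ((∑ i, ‖ω i‖ ^ 2 / g i : ℝ) : ℂ) := by
    rw [star_dotProduct, h1]; simp
  have h4 : star (w - B *ᵥ v) ⬝ᵥ (w - B *ᵥ v) =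
      ((∑ i, ‖w i‖ ^ 2 - ∑ i, ‖ω i‖ ^ 2 / g i : ℝ) : ℂ) := by
    rw [star_sub, sub_dotProduct, dotProduct_sub, dotProduct_sub, h1, h2, h3,
      star_dotProduct_self_eq]
    push_cast; ring
  rw [star_dotProduct_self_eq] at h4
  have h5 : ∑ i, ‖(w - B *ᵥ v) i‖ ^ 2 = ∑ i, ‖w i‖ ^ 2 - ∑ i, ‖ω i‖ ^ 2 / g i := by
    exact_mod_cast h4
  have h6 : 0 ≤ ∑ i, ‖(w - B *ᵥ v) i‖ ^ 2 := by positivity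
  linarith

/-- Weighted AM-GM: the form p u² - 2 c u y + X y² has nonpositive discriminant. -/
lemma two_mul_le_of_sq_le_mul {c p X u y : ℝ} (hp : 0 ≤ p) (hX : 0 ≤ X)
    (h : c ^ 2 ≤ p * X) : 2 * (c * (u * y)) ≤ p * u ^ 2 + X * y ^ 2 := by
  have h1 : c ≤ √p * √X := by
    rw [← Real.sqrt_mul hp]; exact Real.le_sqrt_of_sq_le h
  have h1' : -(√p * √X) ≤ c := by
    rw [← Real.sqrt_mul hp]; exact neg_le_of_abs_le (Real.abs_le_sqrt h)
  have hp' := Real.sq_sqrt hp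
  have hX' := Real.sq_sqrt hX
  rcases le_total 0 (u * y) with h0 | h0
  · nlinarith [sq_nonneg (√p * u - √X * y), mul_le_mul_of_nonneg_right h1 h0]
  · nlinarith [sq_nonneg (√p * u + √X * y), mul_le_mul_of_nonpos_right h1' h0]

lemma two_mul_re_star_mul_le {ρ : ℝ} (hρ : 0 < ρ) (w u : ℂ) :
    2 * (star w * u).re ≤ 1 / ρ * ‖w‖ ^ 2 + ρ * ‖u‖ ^ 2 := by
  have h1 : (star w * u).re ≤ ‖w‖ * ‖u‖ := by
    calc _ ≤ ‖star w * u‖ := Complex.re_le_norm _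
      _ = _ := by rw [norm_mul, norm_star]
  have h2 := two_mul_le_of_sq_le_mul (c := 1) (p := 1 / ρ) (X := ρ) (u := ‖w‖) (y := ‖u‖)
    (by positivity) hρ.le (by field_simp; norm_num)
  linarith

/-- The quadratic bound behind the optimality of parallel modes: an input supported on modes of
relay gain at most `D` is received no better than through the best scalar gain up to `D`. -/
lemma two_mul_re_dotProduct_le {n : ℕ} {V B : Matrix (Fin n) (Fin n) ℂ} {g : Fin n → ℝ}
    (hV : Vᴴ * V = 1) (hg : ∀ i, 0 ≤ g i) (hB : Bᴴ * B = diagonal fun i => (g i : ℂ))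
    {e b μ η ρ κ : ℝ} (hρ : 1 ≤ ρ) (w y : Fin n → ℂ)
    (hy : ∀ i, y i ≠ 0 → ρ ≤ κ * (μ + η * g i) ∧
      e ^ 2 * g i ≤ (κ * (μ + η * g i) - ρ) * (1 - 1 / ρ + b ^ 2 * g i)) :
    2 * (star w ⬝ᵥ (V *ᵥ y + (e : ℂ) • (B *ᵥ y))).re ≤
      ∑ i, ‖w i‖ ^ 2 + b ^ 2 * ∑ i, ‖(Bᴴ *ᵥ w) i‖ ^ 2 +
        κ * ∑ i, (μ + η * g i) * ‖y i‖ ^ 2 := by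
  have hρ0 : 0 < ρ := by linarith
  set ω := Bᴴ *ᵥ w with hω
  have hρ1 : 0 ≤ 1 - 1 / ρ := by
    rw [sub_nonneg, div_le_one hρ0]; exact hρ
  have hVy : ∑ i, ‖(V *ᵥ y) i‖ ^ 2 = ∑ i, ‖y i‖ ^ 2 := by
    have : star (V *ᵥ y) ⬝ᵥ (V *ᵥ y) = star y ⬝ᵥ y := by
      rw [star_mulVec, ← dotProduct_mulVec, mulVec_mulVec, hV, one_mulVec]
    rw [star_dotProduct_self_eq, star_dotProduct_self_eq] at this
    exact_mod_cast this
  -- The direct path spends the share 1/ρ of ‖w‖². The share 1 - 1/ρ is spread over the columns of B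
  -- by Bessel, so the relay path reduces to one discriminant inequality per mode, which is `hy`
  -- divided by g i.
  have h1 : 2 * (star w ⬝ᵥ (V *ᵥ y)).re ≤ 1 / ρ * ∑ i, ‖w i‖ ^ 2 + ρ * ∑ i, ‖y i‖ ^ 2 := by
    rw [← hVy, dotProduct, Complex.re_sum, Finset.mul_sum, Finset.mul_sum, Finset.mul_sum,
      ← Finset.sum_add_distrib]
    exact Finset.sum_le_sum fun i _ => two_mul_re_star_mul_le hρ0 _ _
  have hω0 : ∀ i, g i = 0 → ω i = 0 := by
    intro i hi
    have hcol : ∑ j, ‖B j i‖ ^ 2 = 0 := by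
      have := congrFun (congrFun hB i) i
      rw [mul_apply, diagonal_apply_eq, hi] at this
      simp only [conjTranspose_apply, RCLike.star_def, Complex.conj_mul'] at this
      exact_mod_cast this
    have hz : ∀ j, B j i = 0 := by
      intro j
      have := (Finset.sum_eq_zero_iff_of_nonneg (fun j _ => by positivity)).1 hcol j
        (Finset.mem_univ _)
      simpa using this
    simp [hω, mulVec, dotProduct, hz]
  have h2 : 2 * (star w ⬝ᵥ ((e : ℂ) • (B *ᵥ y))).re ≤
      ∑ i, ((1 - 1 / ρ) * (‖ω i‖ ^ 2 / g i) + b ^ 2 * ‖ω i‖ ^ 2 +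
        (κ * (μ + η * g i) - ρ) * ‖y i‖ ^ 2) := by
    have h3 : star w ⬝ᵥ ((e : ℂ) • (B *ᵥ y)) = ∑ i, (e : ℂ) * (star (ω i) * y i) := by
      rw [dotProduct_smul, dotProduct_mulVec, hω, smul_eq_mul, dotProduct, Finset.mul_sum]
      refine Finset.sum_congr rfl fun i _ => ?_
      rw [← Pi.star_apply, star_mulVec, conjTranspose_conjTranspose]
    rw [h3, Complex.re_sum, Finset.mul_sum]
    refine Finset.sum_le_sum fun i _ => ?_
    rw [Complex.re_ofReal_mul]
    by_cases hyi : y i = 0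
    · have h4 : 0 ≤ (1 - 1 / ρ) * (‖ω i‖ ^ 2 / g i) :=
        mul_nonneg hρ1 (div_nonneg (by positivity) (hg i))
      have h5 : 0 ≤ b ^ 2 * ‖ω i‖ ^ 2 := by positivity
      simp only [hyi, mul_zero, Complex.zero_re, norm_zero, ne_eq, OfNat.ofNat_ne_zero,
        not_false_eq_true, zero_pow, add_zero]
      linarith
    · obtain ⟨hX, hq⟩ := hy i hyi
      rcases (hg i).eq_or_lt with h0 | h0
      · rw [hω0 i h0.symm]
        simp only [star_zero, zero_mul, Complex.zero_re, mul_zero, norm_zero]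
        have : 0 ≤ (κ * (μ + η * g i) - ρ) * ‖y i‖ ^ 2 :=
          mul_nonneg (by linarith) (by positivity)
        simpa using this
      · have hle : e * (star (ω i) * y i).re ≤ |e| * (‖ω i‖ * ‖y i‖) := by
          calc e * (star (ω i) * y i).re ≤ |e * (star (ω i) * y i).re| := le_abs_self _
            _ = |e| * |(star (ω i) * y i).re| := abs_mul _ _
            _ ≤ |e| * ‖star (ω i) * y i‖ := by gcongr; exact Complex.abs_re_le_norm _
            _ = _ := by rw [norm_mul, norm_star]
        have h4 := two_mul_le_of_sq_le_mul (c := |e|) (p := (1 - 1 / ρ) / g i + b ^ 2)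
          (X := κ * (μ + η * g i) - ρ) (u := ‖ω i‖) (y := ‖y i‖) (by positivity)
          (by linarith) (by
            rw [sq_abs]
            have : ((1 - 1 / ρ) / g i + b ^ 2) * (κ * (μ + η * g i) - ρ) =
              ((κ * (μ + η * g i) - ρ) * (1 - 1 / ρ + b ^ 2 * g i)) / g i := by
                field_simp
            rw [this, le_div_iff₀ h0]
            exact hq)
        have h5 : ((1 - 1 / ρ) / g i + b ^ 2) * ‖ω i‖ ^ 2 =
            (1 - 1 / ρ) * (‖ω i‖ ^ 2 / g i) + b ^ 2 * ‖ω i‖ ^ 2 := by ring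
        linarith
  have h6 : ∑ i, ((1 - 1 / ρ) * (‖ω i‖ ^ 2 / g i) + b ^ 2 * ‖ω i‖ ^ 2 +
        (κ * (μ + η * g i) - ρ) * ‖y i‖ ^ 2) = (1 - 1 / ρ) * ∑ i, ‖ω i‖ ^ 2 / g i +
      b ^ 2 * ∑ i, ‖ω i‖ ^ 2 + κ * ∑ i, (μ + η * g i) * ‖y i‖ ^ 2 - ρ * ∑ i, ‖y i‖ ^ 2 := by
    simp only [Finset.mul_sum, ← Finset.sum_add_distrib, ← Finset.sum_sub_distrib]
    exact Finset.sum_congr rfl fun i _ => by ring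
  have h7 := mul_le_mul_of_nonneg_left (sum_sq_div_le_of_orthogonal hB w) hρ1
  rw [dotProduct_add, Complex.add_re]
  rw [← hω] at h7
  nlinarith

lemma posDef_one_add_smul_mul_conjTranspose {n : ℕ} (b : ℝ) (H : Matrix (Fin n) (Fin n) ℂ) :
    (1 + ((b ^ 2 : ℝ) : ℂ) • (H * Hᴴ)).PosDef := by
  refine PosDef.one.add_posSemidef ((posSemidef_self_mul_conjTranspose H).smul ?_)
  exact_mod_cast sq_nonneg b

/-! ### Weak duality for matrix relays. -/

/-- Weak duality for arbitrary relay matrices: a Lagrangian bound that holds for every scalar relay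
gain and input power holds for every relay matrix and input covariance. -/
theorem log_det_ratio_le_of_scalar_bound {n : ℕ} {a b μ ν L : ℝ} (hμ : 0 < μ) (hν : 0 ≤ ν)
    (hL : ∀ l p : ℝ, 0 ≤ l → 0 ≤ p →
      Real.log (1 + p * ((1 + |a * b| * l) ^ 2 / (1 + b ^ 2 * l ^ 2))) ≤
        L + μ * p + ν * (l ^ 2 * (a ^ 2 * p + 1)))
    (H : Matrix (Fin n) (Fin n) ℂ) {S : Matrix (Fin n) (Fin n) ℂ} (hS : S.PosSemidef) :
    Real.log (((1 + ((a * b : ℝ) : ℂ) • H) * S * (1 + ((a * b : ℝ) : ℂ) • H)ᴴ +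
        (1 + ((b ^ 2 : ℝ) : ℂ) • (H * Hᴴ))).det.re / (1 + ((b ^ 2 : ℝ) : ℂ) • (H * Hᴴ)).det.re) ≤
      n * L + μ * S.trace.re + ν * (H * (((a ^ 2 : ℝ) : ℂ) • S + 1) * Hᴴ).trace.re := by
  set A : Matrix (Fin n) (Fin n) ℂ := 1 + ((a * b : ℝ) : ℂ) • H with hA
  set N : Matrix (Fin n) (Fin n) ℂ := 1 + ((b ^ 2 : ℝ) : ℂ) • (H * Hᴴ) with hN
  have hNpd : N.PosDef := posDef_one_add_smul_mul_conjTranspose b H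
  have hNunit : IsUnit N.det := (isUnit_iff_isUnit_det N).1 hNpd.isUnit
  obtain ⟨V, g, hV1, hV2, hganti, hG⟩ :=
    exists_antitone_spectral (posSemidef_conjTranspose_mul_self H).1
  set B := H * V with hB
  have hBB : Bᴴ * B = diagonal fun i => (g i : ℂ) := by
    calc Bᴴ * B = Vᴴ * (Hᴴ * H) * V := by
          rw [hB, conjTranspose_mul]; simp only [Matrix.mul_assoc]
      _ = (Vᴴ * V) * (diagonal fun i => (g i : ℂ)) * (Vᴴ * V) := by
          rw [hG]; simp only [Matrix.mul_assoc]
      _ = _ := by rw [hV1, one_mul, mul_one]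
  have hg : ∀ i, 0 ≤ g i := by
    intro i
    have := (posSemidef_conjTranspose_mul_self B).diag_nonneg (i := i)
    rw [hBB, diagonal_apply_eq] at this
    exact_mod_cast this
  have hBBH : B * Bᴴ = H * Hᴴ := by
    rw [hB, conjTranspose_mul, Matrix.mul_assoc, ← Matrix.mul_assoc V, hV2, one_mul]
  set η := ν * a ^ 2 with hη
  have hη0 : 0 ≤ η := by positivity
  -- m i is the price of unit source power in direction i: μ at the source plus ν a² g i for its
  -- amplification by the relay. After rescaling by √m the priced power is the trace of S'.
  set m : Fin n → ℝ := fun i => μ + η * g i with hm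
  have hm0 : ∀ i, 0 < m i := fun i => by
    have := mul_nonneg hη0 (hg i)
    simp only [hm]; linarith
  have hsq : ∀ i, √(m i) * √(m i) = m i := fun i => Real.mul_self_sqrt (hm0 i).le
  have hsq0 : ∀ i, √(m i) ≠ 0 := fun i => (Real.sqrt_pos.2 (hm0 i)).ne'
  set R : Matrix (Fin n) (Fin n) ℂ := diagonal fun i => (√(m i) : ℂ) with hR
  set Ri : Matrix (Fin n) (Fin n) ℂ := diagonal fun i => (((√(m i))⁻¹ : ℝ) : ℂ) with hRi
  have hRH : Rᴴ = R := by rw [hR, diagonal_conjTranspose]; congr 1; ext i; simp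
  have hRiH : Riᴴ = Ri := by rw [hRi, diagonal_conjTranspose]; congr 1; ext i; simp
  have hRR : Ri * R = 1 := by
    rw [hR, hRi, diagonal_mul_diagonal, ← diagonal_one]; congr 1; ext i
    exact_mod_cast inv_mul_cancel₀ (hsq0 i)
  have hRR' : R * Ri = 1 := by
    rw [hR, hRi, diagonal_mul_diagonal, ← diagonal_one]; congr 1; ext i
    exact_mod_cast mul_inv_cancel₀ (hsq0 i)
  set W := Vᴴ * S * V with hW
  set S' := R * W * R with hS'
  have hWpsd : W.PosSemidef := hS.conjTranspose_mul_mul_same V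
  have hS'psd : S'.PosSemidef := by
    have := hWpsd.conjTranspose_mul_mul_same R
    rwa [hRH] at this
  set J := A * V * Ri with hJ
  set E := Jᴴ * N⁻¹ * J with hE
  have hEpsd : E.PosSemidef := hNpd.inv.posSemidef.conjTranspose_mul_mul_same J
  have hASA : A * S * Aᴴ = J * S' * Jᴴ := by
    have : J * S' * Jᴴ = A * V * (Ri * R) * W * (R * Ri) * Vᴴ * Aᴴ := by
      rw [hJ, hS', conjTranspose_mul, conjTranspose_mul, hRiH]; simp only [Matrix.mul_assoc]
    rw [this, hRR, hRR', mul_one, mul_one, hW]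
    have : A * V * (Vᴴ * S * V) * Vᴴ * Aᴴ = A * (V * Vᴴ) * S * (V * Vᴴ) * Aᴴ := by
      simp only [Matrix.mul_assoc]
    rw [this, hV2, mul_one, mul_one]
  have hdet : (A * S * Aᴴ + N).det = N.det * (1 + S' * E).det := by
    have h1 : A * S * Aᴴ + N = N * (1 + (N⁻¹ * J) * (S' * Jᴴ)) := by
      rw [hASA, mul_add, mul_one, add_comm]
      congr 1
      simp only [Matrix.mul_assoc]
      rw [mul_nonsing_inv_cancel_left _ _ hNunit]
    rw [h1, det_mul, det_one_add_mul_comm, hE]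
    simp only [Matrix.mul_assoc]
  have hNdet : N.det = (N.det.re : ℂ) :=
    Complex.ext rfl (by simpa using (Complex.pos_iff.1 hNpd.det_pos).2.symm)
  have hNre : 0 < N.det.re := (Complex.pos_iff.1 hNpd.det_pos).1
  have hratio : (A * S * Aᴴ + N).det.re / N.det.re = (1 + S' * E).det.re := by
    rw [hdet, hNdet, Complex.re_ofReal_mul, Complex.ofReal_re]
    field_simp
  -- The cap at k is √(g k): as g decreases, vectors supported from k on meet only modes with gain
  -- at most that.
  choose l ρ κ hl0 hlD hρ1 hκ hbound using fun k =>
    exists_gain_bound (abs_nonneg (a * b)) (sq_nonneg b) hμ hη0 (Real.sqrt_nonneg (g k))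
  obtain ⟨s, hs0, hstr, hslog⟩ := log_det_one_add_mul_le hS'psd hEpsd (κ := κ) (by
    intro k x hx
    set y : Fin n → ℂ := Ri *ᵥ x with hy
    have hyx : ∀ i, y i = (((√(m i))⁻¹ : ℝ) : ℂ) * x i := fun i => by
      rw [hy, hRi, mulVec_diagonal]
    have hJx : J *ᵥ x = V *ᵥ y + ((a * b : ℝ) : ℂ) • (B *ᵥ y) := by
      have h0 : J = V * Ri + ((a * b : ℝ) : ℂ) • (B * Ri) := by
        rw [hJ, hA, hB, add_mul, add_mul, one_mul, Matrix.smul_mul, Matrix.smul_mul]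
      rw [h0, hy, add_mulVec, smul_mulVec, mulVec_mulVec, mulVec_mulVec]
    -- For this w both ⟨w, J x⟩ and ⟨w, N w⟩ equal ⟨x, E x⟩, so 2 Re⟨w, J x⟩ ≤ ⟨w, N w⟩ + κ ‖x‖² is
    -- the bound sought.
    set w := N⁻¹ *ᵥ (J *ᵥ x) with hw
    have hNw : N *ᵥ w = J *ᵥ x := by
      rw [hw, mulVec_mulVec, mul_nonsing_inv _ hNunit, one_mulVec]
    have h1 := two_mul_re_dotProduct_le (e := a * b) (b := b) (μ := μ) (η := η) (κ := κ k) hV1 hg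
      hBB (hρ1 k) w y (by
        intro i hyi
        have hki : k ≤ i := by
          by_contra hlt
          exact hyi (by rw [hyx, hx i (not_le.1 hlt), mul_zero])
        have := hbound k (g i) (hg i) (by rw [Real.sq_sqrt (hg k)]; exact hganti hki)
        rwa [sq_abs] at this)
    have h2 : ∑ i, ‖w i‖ ^ 2 + b ^ 2 * ∑ i, ‖(Bᴴ *ᵥ w) i‖ ^ 2 = (star w ⬝ᵥ (N *ᵥ w)).re := by
      clear_value w
      have : star w ⬝ᵥ (N *ᵥ w) =
          ((∑ i, ‖w i‖ ^ 2 + b ^ 2 * ∑ i, ‖(Bᴴ *ᵥ w) i‖ ^ 2 : ℝ) : ℂ) := by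
        rw [hN, ← hBBH, add_mulVec, one_mulVec, smul_mulVec, dotProduct_add, dotProduct_smul,
          ← mulVec_mulVec, dotProduct_mulVec (star w) B,
          show star w ᵥ* B = star (Bᴴ *ᵥ w) by rw [star_mulVec, conjTranspose_conjTranspose],
          star_dotProduct_self_eq, star_dotProduct_self_eq]
        push_cast; rfl
      rw [this, Complex.ofReal_re]
    have h3 : ∑ i, (μ + η * g i) * ‖y i‖ ^ 2 = ∑ i, ‖x i‖ ^ 2 := by
      refine Finset.sum_congr rfl fun i _ => ?_
      rw [hyx, norm_mul, Complex.norm_real, mul_pow, norm_inv, inv_pow, Real.norm_eq_abs, sq_abs,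
        Real.sq_sqrt (hm0 i).le, ← mul_assoc, show μ + η * g i = m i from rfl,
        mul_inv_cancel₀ (hm0 i).ne', one_mul]
    rw [h2, h3, ← hJx, hNw] at h1
    have h4 : star x ⬝ᵥ (E *ᵥ x) = star (J *ᵥ x) ⬝ᵥ w := by
      rw [hE, ← mulVec_mulVec, ← mulVec_mulVec, dotProduct_mulVec, star_mulVec]
    have h5 : (star (J *ᵥ x) ⬝ᵥ w).re = (star w ⬝ᵥ (J *ᵥ x)).re := by
      rw [star_dotProduct, RCLike.star_def, Complex.conj_re]
    rw [h4, h5]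
    linarith)
  rw [hratio]
  refine hslog.trans ?_
  have hterm : ∀ k, Real.log (1 + κ k * s k) ≤ L + s k + ν * g k := by
    intro k
    have hml : 0 < μ + η * l k ^ 2 := by positivity
    -- s k is a priced power; dividing by the price at gain l k gives the power of a scalar mode.
    -- Its relay noise cost ν (l k)² is at most ν g k, the cost H really pays.
    have h1 := hL (l k) (s k / (μ + η * l k ^ 2)) (hl0 k) (div_nonneg (hs0 k) hml.le)
    have h2 : s k / (μ + η * l k ^ 2) * ((1 + |a * b| * l k) ^ 2 / (1 + b ^ 2 * l k ^ 2)) =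
        κ k * s k := by
      rw [← hκ k]; field_simp
    rw [h2] at h1
    have h3 : L + μ * (s k / (μ + η * l k ^ 2)) +
        ν * (l k ^ 2 * (a ^ 2 * (s k / (μ + η * l k ^ 2)) + 1)) = L + s k + ν * l k ^ 2 := by
      have : L + μ * (s k / (μ + η * l k ^ 2)) +
        ν * (l k ^ 2 * (a ^ 2 * (s k / (μ + η * l k ^ 2)) + 1)) =
        L + (s k / (μ + η * l k ^ 2)) * (μ + η * l k ^ 2) + ν * l k ^ 2 := by rw [hη]; ring
      rw [this, div_mul_cancel₀ _ hml.ne']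
    have h4 : l k ^ 2 ≤ g k := by
      have := pow_le_pow_left₀ (hl0 k) (hlD k) 2
      rwa [Real.sq_sqrt (hg k)] at this
    rw [h3] at h1
    linarith [mul_le_mul_of_nonneg_left h4 hν]
  refine (Finset.sum_le_sum fun k _ => hterm k).trans (le_of_eq ?_)
  have htrS : S.trace.re = ∑ k, (W k k).re := by
    have : W.trace = S.trace := by rw [hW, Matrix.trace_mul_cycle, hV2, one_mul]
    rw [← this, Matrix.trace, Complex.re_sum]; rfl
  have htrS' : S'.trace.re = ∑ k, m k * (W k k).re := by
    rw [Matrix.trace, Complex.re_sum]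
    refine Finset.sum_congr rfl fun k _ => ?_
    rw [diag_apply, hS', hR, mul_diagonal, diagonal_mul]
    have : (√(m k) : ℂ) * W k k * (√(m k) : ℂ) = ((m k : ℝ) : ℂ) * W k k := by
      rw [mul_right_comm]; congr 1; exact_mod_cast hsq k
    rw [this, Complex.re_ofReal_mul]
  have htrHH : (H * Hᴴ).trace.re = ∑ k, g k := by
    rw [← hBBH, Matrix.trace_mul_comm, hBB, trace_diagonal, Complex.re_sum]; rfl
  have htrHSH : (H * S * Hᴴ).trace.re = ∑ k, g k * (W k k).re := by
    have : (H * S * Hᴴ).trace = ((diagonal fun i => (g i : ℂ)) * W).trace := by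
      rw [Matrix.trace_mul_cycle, hG, hW, Matrix.mul_assoc, Matrix.mul_assoc,
        Matrix.trace_mul_comm]
      simp only [Matrix.mul_assoc]
    rw [this, Matrix.trace, Complex.re_sum]
    refine Finset.sum_congr rfl fun k _ => ?_
    rw [diag_apply, diagonal_mul, Complex.re_ofReal_mul]
  have hexp : (H * (((a ^ 2 : ℝ) : ℂ) • S + 1) * Hᴴ).trace.re =
      a ^ 2 * (H * S * Hᴴ).trace.re + (H * Hᴴ).trace.re := by
    rw [mul_add, mul_one, add_mul, Matrix.mul_smul, Matrix.smul_mul, trace_add, trace_smul, Complex.add_re,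
      smul_eq_mul, Complex.re_ofReal_mul]
  rw [hexp, htrHSH, htrHH, htrS, Finset.sum_add_distrib, Finset.sum_add_distrib, hstr, htrS',
    ← Finset.mul_sum]
  simp only [hm, hη, add_mul, Finset.sum_add_distrib, ← Finset.mul_sum, mul_assoc]
  simp
  ring

end

/-! ### Single modes: power gain and perspective of the capacity function. -/

/-- The power gain `|1 + a b z|² / (1 + b² |z|²)` of a mode with relay gain `z`. -/
def modeGain (a b : ℝ) (z : ℂ) : ℝ := ‖1 + (a : ℂ) * b * z‖ ^ 2 / (1 + b ^ 2 * ‖z‖ ^ 2)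

/-- The perspective `τ 𝒞(x / τ)` of `𝒞`. -/
def perspCap (τ x : ℝ) : ℝ := τ * gaussCap (x / τ)

lemma modeGain_nonneg (a b : ℝ) (z : ℂ) : 0 ≤ modeGain a b z := by
  unfold modeGain; positivity

lemma modeGain_zero (a b : ℝ) : modeGain a b 0 = 1 := by simp [modeGain]

lemma modeGain_le (a b : ℝ) (z : ℂ) :
    modeGain a b z ≤ (1 + |a * b| * ‖z‖) ^ 2 / (1 + b ^ 2 * ‖z‖ ^ 2) := by
  unfold modeGain
  gcongr
  refine (norm_add_le _ _).trans (le_of_eq ?_)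
  rw [norm_one, norm_mul, norm_mul, Complex.norm_real, Complex.norm_real, Real.norm_eq_abs,
    Real.norm_eq_abs, abs_mul]

/-- A real sign that makes `a b` times it nonnegative. -/
def alignSign (a b : ℝ) : ℝ := if 0 ≤ a * b then 1 else -1

lemma mul_alignSign (a b : ℝ) : a * b * alignSign a b = |a * b| := by
  unfold alignSign
  split_ifs with h
  · rw [abs_of_nonneg h, mul_one]
  · rw [abs_of_neg (not_le.1 h)]; ring

lemma abs_alignSign (a b : ℝ) : |alignSign a b| = 1 := by
  unfold alignSign; split_ifs <;> simp

lemma norm_alignSign_mul (a b : ℝ) {l : ℝ} (hl : 0 ≤ l) :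
    ‖((alignSign a b * l : ℝ) : ℂ)‖ = l := by
  rw [Complex.norm_real, Real.norm_eq_abs, abs_mul, abs_alignSign, one_mul, abs_of_nonneg hl]

lemma modeGain_alignSign (a b : ℝ) {l : ℝ} (hl : 0 ≤ l) :
    modeGain a b ((alignSign a b * l : ℝ) : ℂ) = (1 + |a * b| * l) ^ 2 / (1 + b ^ 2 * l ^ 2) := by
  unfold modeGain
  rw [norm_alignSign_mul a b hl]
  congr 2
  have : (1 : ℂ) + (a : ℂ) * b * ((alignSign a b * l : ℝ) : ℂ) = ((1 + |a * b| * l : ℝ) : ℂ) := by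
    rw [← mul_alignSign]; push_cast; ring
  rw [this, Complex.norm_real, Real.norm_eq_abs, abs_of_nonneg (by positivity)]

/-- Gains beyond `|a| / |b|` do not help. -/
lemma modeGain_le_alignSign_min (a b : ℝ) (z : ℂ) :
    modeGain a b z ≤ modeGain a b ((alignSign a b * min ‖z‖ (|a| / |b|) : ℝ) : ℂ) := by
  rw [modeGain_alignSign a b (le_min (norm_nonneg _) (by positivity))]
  refine (modeGain_le a b z).trans ?_
  rcases le_total ‖z‖ (|a| / |b|) with h | h
  · rw [min_eq_left h]
  · rw [min_eq_right h]
    -- For b = 0 the quotient |a| / |b| is zero and every gain factor is 1. Otherwise Cauchy-Schwarz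
    -- gives (1 + |a||b|l)² ≤ (1 + a²)(1 + b²l²), with equality at l = |a| / |b|.
    rcases eq_or_ne b 0 with rfl | hb
    · simp
    · have hb' : 0 < |b| := abs_pos.2 hb
      have hr : (1 + |a * b| * (|a| / |b|)) ^ 2 / (1 + b ^ 2 * (|a| / |b|) ^ 2) = 1 + a ^ 2 := by
        have h1 : |a * b| * (|a| / |b|) = a ^ 2 := by
          rw [abs_mul, ← sq_abs a]; field_simp
        have h2 : b ^ 2 * (|a| / |b|) ^ 2 = a ^ 2 := by
          rw [div_pow, sq_abs, sq_abs]; field_simp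
        rw [h1, h2]
        have : (1 + a ^ 2) ≠ 0 := by positivity
        field_simp
      rw [hr, div_le_iff₀ (by positivity), abs_mul, ← sq_abs a, ← sq_abs b]
      nlinarith [sq_nonneg (|a| - |b| * ‖z‖)]

lemma gaussCap_nonneg {x : ℝ} (hx : 0 ≤ x) : 0 ≤ gaussCap x := by
  unfold gaussCap
  have := Real.log_nonneg (by linarith : (1 : ℝ) ≤ 1 + x)
  positivity

lemma gaussCap_le_gaussCap {x y : ℝ} (hx : 0 ≤ x) (hxy : x ≤ y) : gaussCap x ≤ gaussCap y := by
  unfold gaussCap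
  have := Real.log_le_log (by linarith : (0 : ℝ) < 1 + x) (by linarith : 1 + x ≤ 1 + y)
  linarith

/-- From 1 + x ≤ (1 + √x)². Under the perspective it becomes the bound √(τ x), which settles
continuity at τ = 0. -/
lemma gaussCap_le_sqrt {x : ℝ} (hx : 0 ≤ x) : gaussCap x ≤ √x := by
  unfold gaussCap
  have h1 : Real.log (1 + x) ≤ 2 * √x := by
    calc Real.log (1 + x) ≤ Real.log ((1 + √x) ^ 2) := by
          refine Real.log_le_log (by linarith) ?_
          nlinarith [Real.sq_sqrt hx, Real.sqrt_nonneg x]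
      _ = 2 * Real.log (1 + √x) := by rw [Real.log_pow]; norm_num
      _ ≤ 2 * √x := by
          have := Real.log_le_sub_one_of_pos (by positivity : 0 < 1 + √x)
          linarith
  linarith

lemma perspCap_zero_left (x : ℝ) : perspCap 0 x = 0 := by simp [perspCap]

lemma perspCap_nonneg {τ x : ℝ} (hτ : 0 ≤ τ) (hx : 0 ≤ x) : 0 ≤ perspCap τ x :=
  mul_nonneg hτ (gaussCap_nonneg (div_nonneg hx hτ))

lemma perspCap_mono_right {τ x y : ℝ} (hτ : 0 ≤ τ) (hx : 0 ≤ x) (hxy : x ≤ y) :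
    perspCap τ x ≤ perspCap τ y :=
  mul_le_mul_of_nonneg_left
    (gaussCap_le_gaussCap (div_nonneg hx hτ) (div_le_div_of_nonneg_right hxy hτ)) hτ

lemma perspCap_le_sqrt {τ x : ℝ} (hτ : 0 ≤ τ) (hx : 0 ≤ x) : perspCap τ x ≤ √(τ * x) := by
  unfold perspCap
  rcases hτ.eq_or_lt with rfl | h0
  · simp
  · refine (mul_le_mul_of_nonneg_left (gaussCap_le_sqrt (div_nonneg hx hτ)) hτ).trans (le_of_eq ?_)
    have : τ * x = τ ^ 2 * (x / τ) := by field_simp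
    rw [this, Real.sqrt_mul (by positivity), Real.sqrt_sq hτ]

/-- Squeezing the same power into a band narrower by s raises the power density, so the rate per
unit of band does not drop. -/
lemma mul_perspCap_le {τ x s : ℝ} (hτ : 0 ≤ τ) (hx : 0 ≤ x) (hs0 : 0 < s) (hs1 : s ≤ 1) :
    s * perspCap τ x ≤ perspCap (s * τ) x := by
  unfold perspCap
  rcases hτ.eq_or_lt with rfl | h0
  · simp
  · rw [← mul_assoc]
    refine mul_le_mul_of_nonneg_left (gaussCap_le_gaussCap (by positivity) ?_) (by positivity)
    exact div_le_div_of_nonneg_left hx (by positivity) (by nlinarith)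

/-- The perspective of `𝒞` is jointly continuous on the closed quadrant. -/
lemma continuousOn_perspCap :
    ContinuousOn (fun p : ℝ × ℝ => perspCap p.1 p.2) {p | 0 ≤ p.1 ∧ 0 ≤ p.2} := by
  rintro ⟨τ, x⟩ ⟨hτ, hx⟩
  simp only at hτ hx
  rcases hτ.eq_or_lt with rfl | h0
  · unfold ContinuousWithinAt
    simp only [perspCap_zero_left]
    refine tendsto_of_tendsto_of_tendsto_of_le_of_le' (g := fun _ => (0 : ℝ))
      (h := fun p : ℝ × ℝ => √(p.1 * p.2)) tendsto_const_nhds ?_ ?_ ?_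
    · have hc : Continuous fun p : ℝ × ℝ => √(p.1 * p.2) := by fun_prop
      have := hc.tendsto (0, x)
      simp only [zero_mul, Real.sqrt_zero] at this
      exact this.mono_left nhdsWithin_le_nhds
    · filter_upwards [self_mem_nhdsWithin] with p hp
      exact perspCap_nonneg hp.1 hp.2
    · filter_upwards [self_mem_nhdsWithin] with p hp
      exact perspCap_le_sqrt hp.1 hp.2
  · apply ContinuousAt.continuousWithinAt
    unfold perspCap gaussCap
    have h1 : (τ, x).1 ≠ 0 := h0.ne'
    have h2 : 1 + (τ, x).2 / (τ, x).1 ≠ 0 := by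
      have : 0 ≤ x / τ := by positivity
      simp only; linarith
    fun_prop (disch := assumption)

/-! ### Existence of an optimal choice of modes. -/

namespace Modes

variable {m : ℕ}

lemma rate_eq (a b σ P : ℝ) (q : Modes m) :
    q.rate a b σ P = perspCap (q.τ 0) (q.θ 0 * P / σ ^ 2) +
      ∑ j : Fin m, perspCap (q.τ j.succ) (q.θ j.succ * P / σ ^ 2 * modeGain a b (q.gain j)) := by
  unfold rate perspCap
  congr 1
  · rw [div_div, mul_comm (σ ^ 2)]
  · refine Finset.sum_congr rfl fun j _ => ?_
    congr 2
    unfold modeGain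
    ring

/-- Choice of modes with aligned real gains. -/
def aligned (a b : ℝ) (p : (Fin (m + 1) → ℝ) × (Fin (m + 1) → ℝ) × (Fin m → ℝ)) : Modes m where
  τ := p.1
  θ := p.2.1
  gain := fun j => ((alignSign a b * p.2.2 j : ℝ) : ℂ)

lemma isValid_iff {q : Modes m} :
    q.IsValid ↔ q.τ ∈ stdSimplex ℝ (Fin (m + 1)) ∧ q.θ ∈ stdSimplex ℝ (Fin (m + 1)) :=
  ⟨fun h => ⟨⟨h.τ_nonneg, h.sum_τ⟩, ⟨h.θ_nonneg, h.sum_θ⟩⟩,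
    fun h => ⟨h.1.1, h.2.1, h.1.2, h.2.2⟩⟩

/-- The rate is attained by a choice of modes with real gains. -/
theorem exists_isMax_rate (m : ℕ) (a b σ : ℝ) {P Q : ℝ} (hP : 0 ≤ P) (hQ : 0 ≤ Q) :
    ∃ (q : Modes m) (l : Fin m → ℝ), (∀ j, q.gain j = (l j : ℂ)) ∧ q.IsValid ∧
      q.relayPower a σ P ≤ Q ∧ ∀ q' : Modes m, q'.IsValid → q'.relayPower a σ P ≤ Q →
        q'.rate a b σ P ≤ q.rate a b σ P := by
  -- Aligned gains cut at |a| / |b| lose no rate and need no more relay power, so it suffices to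
  -- search this compact set.
  set Z : Set ((Fin (m + 1) → ℝ) × (Fin (m + 1) → ℝ) × (Fin m → ℝ)) :=
    stdSimplex ℝ (Fin (m + 1)) ×ˢ stdSimplex ℝ (Fin (m + 1)) ×ˢ
      Set.Icc (fun _ => (0 : ℝ)) (fun _ => |a| / |b|) with hZ
  have hZc : IsCompact Z :=
    (isCompact_stdSimplex ℝ _).prod ((isCompact_stdSimplex ℝ _).prod isCompact_Icc)
  have hpow : Continuous fun p => (aligned (m := m) a b p).relayPower a σ P := by
    unfold relayPower aligned
    fun_prop
  have hK : IsCompact (Z ∩ {p | (aligned (m := m) a b p).relayPower a σ P ≤ Q}) :=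
    hZc.inter_right (isClosed_le hpow continuous_const)
  have hgain : Continuous fun z : ℂ => modeGain a b z := by
    unfold modeGain
    have : ∀ z : ℂ, (1 + b ^ 2 * ‖z‖ ^ 2 : ℝ) ≠ 0 := fun z => by positivity
    fun_prop (disch := assumption)
  have hcont : ContinuousOn (fun p => (aligned (m := m) a b p).rate a b σ P)
      (Z ∩ {p | (aligned (m := m) a b p).relayPower a σ P ≤ Q}) := by
    simp only [rate_eq]
    refine ContinuousOn.add ?_ (continuousOn_finsetSum _ fun j _ => ?_)
    · refine continuousOn_perspCap.comp (f := fun p => ((aligned (m := m) a b p).τ 0,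
        (aligned (m := m) a b p).θ 0 * P / σ ^ 2)) (Continuous.continuousOn ?_) ?_
      · unfold aligned; fun_prop
      · rintro p ⟨⟨hτ, hθ, -⟩, -⟩
        have := hθ.1 0
        exact ⟨hτ.1 0, by simp only [aligned]; positivity⟩
    · refine continuousOn_perspCap.comp (f := fun p => ((aligned (m := m) a b p).τ j.succ,
        (aligned (m := m) a b p).θ j.succ * P / σ ^ 2 *
          modeGain a b ((aligned (m := m) a b p).gain j))) (Continuous.continuousOn ?_) ?_
      · unfold aligned; fun_prop
      · rintro p ⟨⟨hτ, hθ, -⟩, -⟩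
        have := hθ.1 j.succ
        refine ⟨hτ.1 _, ?_⟩
        simp only [aligned]
        exact mul_nonneg (by positivity) (modeGain_nonneg _ _ _)
  have hne : (Z ∩ {p | (aligned (m := m) a b p).relayPower a σ P ≤ Q}).Nonempty := by
    refine ⟨(Pi.single 0 1, Pi.single 0 1, 0), ⟨single_mem_stdSimplex ℝ 0,
      single_mem_stdSimplex ℝ 0, le_rfl, fun _ => by positivity⟩, ?_⟩
    simpa [relayPower, aligned] using hQ
  obtain ⟨p, hp, hmax⟩ := hK.exists_isMaxOn hne hcont
  refine ⟨aligned a b p, fun j => alignSign a b * p.2.2 j, fun j => rfl,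
    isValid_iff.2 ⟨hp.1.1, hp.1.2.1⟩, hp.2, fun q' hq' hpow' => ?_⟩
  set p' : (Fin (m + 1) → ℝ) × (Fin (m + 1) → ℝ) × (Fin m → ℝ) :=
    (q'.τ, q'.θ, fun j => min ‖q'.gain j‖ (|a| / |b|)) with hp'
  have hle : q'.rate a b σ P ≤ (aligned a b p').rate a b σ P := by
    rw [rate_eq, rate_eq]
    refine add_le_add le_rfl (Finset.sum_le_sum fun j _ => ?_)
    have h1 := hq'.θ_nonneg j.succ
    refine perspCap_mono_right (hq'.τ_nonneg _)
      (mul_nonneg (by positivity) (modeGain_nonneg _ _ _)) ?_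
    exact mul_le_mul_of_nonneg_left (modeGain_le_alignSign_min a b _) (by positivity)
  refine hle.trans (hmax ⟨⟨(isValid_iff.1 hq').1, (isValid_iff.1 hq').2, ?_, ?_⟩, ?_⟩)
  · exact fun j => le_min (norm_nonneg _) (by positivity)
  · exact fun j => min_le_right _ _
  · refine le_trans (Finset.sum_le_sum fun j _ => ?_) hpow'
    have h1 := hq'.θ_nonneg j.succ
    have h2 := hq'.τ_nonneg j.succ
    have h3 : ‖(aligned a b p').gain j‖ ≤ ‖q'.gain j‖ := by
      simp only [aligned, hp']
      rw [norm_alignSign_mul a b (le_min (norm_nonneg _) (by positivity))]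
      exact min_le_left _ _
    refine mul_le_mul_of_nonneg_right (pow_le_pow_left₀ (norm_nonneg _) h3 2) ?_
    change 0 ≤ a ^ 2 * q'.θ j.succ * P + q'.τ j.succ * σ ^ 2
    positivity

end Modes

/-! ### The convex hull of single modes: Carathéodory, multipliers, spare relay power. -/

/-- The triples (rate, source power, relay power) of single modes. -/
def modeTriples (a b σ : ℝ) : Set (ℝ × ℝ × ℝ) :=
  {t | ∃ (x : ℝ) (z : ℂ), 0 ≤ x ∧
    t = (gaussCap (x / σ ^ 2 * modeGain a b z), x, ‖z‖ ^ 2 * (a ^ 2 * x + σ ^ 2))}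

lemma zero_mem_modeTriples (a b σ : ℝ) : (0, 0, 0) ∈ modeTriples a b σ :=
  ⟨0, 0, le_rfl, by simp [gaussCap]⟩

lemma sum_extend_eq {ι κ : Type*} [Fintype ι] [Fintype κ] {e : ι → κ} (he : Function.Injective e)
    {F : κ → ℝ} {f : ι → ℝ} (h0 : ∀ j, j ∉ Set.range e → F j = 0) (h1 : ∀ i, F (e i) = f i) :
    ∑ j, F j = ∑ i, f i :=
  (Fintype.sum_of_injective e he f F h0 fun i => (h1 i).symm).symm

/-- A convex combination of single modes can be realised by finitely many modes, the last of
which is left free. -/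
lemma exists_modes_of_mem_convexHull {m : ℕ} (hm : 4 ≤ m) {a b σ P : ℝ} (hP : 0 < P)
    {t : ℝ × ℝ × ℝ} (ht : t ∈ convexHull ℝ (modeTriples a b σ)) (htP : t.2.1 ≤ P) :
    ∃ q : Modes (m + 1), q.IsValid ∧ q.τ (Fin.last (m + 1)) = 0 ∧ q.θ (Fin.last (m + 1)) = 0 ∧
      q.relayPower a σ P = t.2.2 ∧ q.rate a b σ P = t.1 := by
  obtain ⟨ι, _, p, w, hps, hind, hw0, hw1, hwt⟩ := eq_pos_convex_span_of_mem_convexHull ht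
  -- Carathéodory: affinely independent points in a three-dimensional space number at most four.
  have hcard : Fintype.card ι ≤ m := by
    have h1 := hind.card_le_finrank_succ
    have h2 := Submodule.finrank_le (vectorSpan ℝ (Set.range p))
    have h3 : Module.finrank ℝ (ℝ × ℝ × ℝ) = 3 := by simp
    omega
  choose x z hx0 hp using fun i => hps (Set.mem_range_self i)
  set e : ι → Fin (m + 1) := fun i => Fin.castLE (by omega) (Fintype.equivFin ι i) with he
  have heinj : Function.Injective e := fun i j hij => by
    simpa [he, Fin.ext_iff, Fin.val_inj] using hij
  have helast : Fin.last m ∉ Set.range e := by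
    rintro ⟨i, hi⟩
    have h1 := congrArg Fin.val hi
    simp only [he, Fin.val_castLE, Fin.val_last] at h1
    have := (Fintype.equivFin ι i).2
    omega
  have hext : ∀ {β : Type} (f : ι → β) (d : Fin (m + 1) → β) (i : ι),
      Function.extend e f d (e i) = f i := fun f d i => heinj.extend_apply f d i
  have hext' : ∀ {β : Type} (f : ι → β) (d : Fin (m + 1) → β) (j : Fin (m + 1)),
      j ∉ Set.range e → Function.extend e f d j = d j := fun f d j hj =>
    Function.extend_apply' f d j hj
  have ht1 : ∑ i, w i * gaussCap (x i / σ ^ 2 * modeGain a b (z i)) = t.1 := by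
    rw [← hwt, Prod.fst_sum]
    exact Finset.sum_congr rfl fun i _ => by rw [hp i]; rfl
  have ht2 : ∑ i, w i * x i = t.2.1 := by
    rw [← hwt, Prod.snd_sum, Prod.fst_sum]
    exact Finset.sum_congr rfl fun i _ => by rw [hp i]; rfl
  have ht3 : ∑ i, w i * (‖z i‖ ^ 2 * (a ^ 2 * x i + σ ^ 2)) = t.2.2 := by
    rw [← hwt, Prod.snd_sum, Prod.snd_sum]
    exact Finset.sum_congr rfl fun i _ => by rw [hp i]; rfl
  set T : Fin (m + 1) → ℝ := Function.extend e w 0 with hT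
  set Θ : Fin (m + 1) → ℝ := Function.extend e (fun i => w i * x i / P) 0 with hΘ
  set g : Fin (m + 1) → ℂ := Function.extend e z 0 with hg
  have hTe : ∀ i, T (e i) = w i := fun i => hext _ _ _
  have hΘe : ∀ i, Θ (e i) = w i * x i / P := fun i => hext _ _ _
  have hge : ∀ i, g (e i) = z i := fun i => hext _ _ _
  have hT0 : ∀ j, j ∉ Set.range e → T j = 0 := fun j hj => hext' _ _ _ hj
  have hΘ0 : ∀ j, j ∉ Set.range e → Θ j = 0 := fun j hj => hext' _ _ _ hj
  have hsumΘ : ∑ j, Θ j = t.2.1 / P := by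
    rw [sum_extend_eq heinj hΘ0 hΘe, ← Finset.sum_div, ht2]
  -- Mode 0 gets no band and absorbs the unused source power, so θ sums to one at no change of rate.
  -- With τ = w and θ = w x / P the power density θ P / τ is x again.
  refine ⟨⟨Fin.cons 0 T, Fin.cons (1 - t.2.1 / P) Θ, g⟩, ⟨?_, ?_, ?_, ?_⟩, ?_, ?_, ?_, ?_⟩
  · refine Fin.cases (by simp) fun j => ?_
    simp only [Fin.cons_succ]
    by_cases hj : j ∈ Set.range e
    · obtain ⟨i, rfl⟩ := hj
      rw [hTe]; exact (hw0 i).le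
    · rw [hT0 j hj]
  · refine Fin.cases ?_ fun j => ?_
    · simp only [Fin.cons_zero]
      rw [sub_nonneg, div_le_one hP]; exact htP
    · simp only [Fin.cons_succ]
      by_cases hj : j ∈ Set.range e
      · obtain ⟨i, rfl⟩ := hj
        have := hw0 i
        have := hx0 i
        rw [hΘe]; positivity
      · rw [hΘ0 j hj]
  · rw [Fin.sum_univ_succ]
    simp only [Fin.cons_zero, Fin.cons_succ]
    rw [sum_extend_eq heinj hT0 hTe, hw1, zero_add]
  · rw [Fin.sum_univ_succ]
    simp only [Fin.cons_zero, Fin.cons_succ]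
    rw [hsumΘ]; ring
  · rw [← Fin.succ_last]; simp only [Fin.cons_succ]; exact hT0 _ helast
  · rw [← Fin.succ_last]; simp only [Fin.cons_succ]; exact hΘ0 _ helast
  · rw [Modes.relayPower, ← ht3]
    simp only [Fin.cons_succ]
    refine sum_extend_eq heinj (fun j hj => ?_) fun i => ?_
    · rw [hT0 j hj, hΘ0 j hj]; simp
    · rw [hTe, hΘe, hge]; field_simp
  · rw [Modes.rate_eq, ← ht1]
    simp only [Fin.cons_succ, Fin.cons_zero]
    rw [perspCap_zero_left, zero_add]
    refine sum_extend_eq heinj (fun j hj => ?_) fun i => ?_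
    · rw [hT0 j hj, perspCap_zero_left]
    · rw [hTe, hΘe, hge, perspCap]
      have := (hw0 i).ne'
      congr 2
      field_simp

/-- The rate of a valid choice of modes lies in the convex hull of the single-mode triples. -/
lemma Modes.IsValid.mem_convexHull {m : ℕ} {q : Modes m} (hq : q.IsValid) (a b : ℝ) {σ P : ℝ}
    (hP : 0 ≤ P) : ∃ p c : ℝ, p ≤ P ∧ c ≤ q.relayPower a σ P ∧
      (q.rate a b σ P, p, c) ∈ convexHull ℝ (modeTriples a b σ) := by
  -- If τ j = 0 the quotient is 0 and the power of that mode is discarded; hence inequalities, not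
  -- equalities, for p and c.
  set x : Fin (m + 1) → ℝ := fun j => q.θ j * P / q.τ j with hx
  set z : Fin (m + 1) → ℂ := Fin.cons 0 q.gain with hz
  have hx0 : ∀ j, 0 ≤ x j := fun j => by
    have := hq.θ_nonneg j
    have := hq.τ_nonneg j
    simp only [hx]; positivity
  have hτx : ∀ j, q.τ j * x j ≤ q.θ j * P := by
    intro j
    simp only [hx]
    rcases (hq.τ_nonneg j).eq_or_lt with h | h
    · rw [← h, zero_mul]; exact mul_nonneg (hq.θ_nonneg j) hP
    · exact (mul_div_cancel₀ _ h.ne').le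
  set y : Fin (m + 1) → ℝ × ℝ × ℝ := fun j =>
    (gaussCap (x j / σ ^ 2 * modeGain a b (z j)), x j, ‖z j‖ ^ 2 * (a ^ 2 * x j + σ ^ 2)) with hy
  have hmem : ∑ j, q.τ j • y j ∈ convexHull ℝ (modeTriples a b σ) :=
    (convex_convexHull ℝ _).sum_mem (fun j _ => hq.τ_nonneg j) hq.sum_τ
      fun j _ => subset_convexHull ℝ _ ⟨x j, z j, hx0 j, rfl⟩
  refine ⟨∑ j, q.τ j * x j, ∑ j, q.τ j * (‖z j‖ ^ 2 * (a ^ 2 * x j + σ ^ 2)), ?_, ?_, ?_⟩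
  · calc ∑ j, q.τ j * x j ≤ ∑ j, q.θ j * P := Finset.sum_le_sum fun j _ => hτx j
      _ = P := by rw [← Finset.sum_mul, hq.sum_θ, one_mul]
  · rw [Fin.sum_univ_succ, Modes.relayPower]
    simp only [hz, Fin.cons_zero, Fin.cons_succ, norm_zero]
    rw [zero_pow two_ne_zero, zero_mul, mul_zero, zero_add]
    refine Finset.sum_le_sum fun j _ => ?_
    have h1 := mul_le_mul_of_nonneg_left (hτx j.succ) (by positivity : 0 ≤ ‖q.gain j‖ ^ 2 * a ^ 2)
    linarith
  · convert hmem using 1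
    refine Prod.ext ?_ (Prod.ext ?_ ?_)
    · rw [Prod.fst_sum, Modes.rate_eq, Fin.sum_univ_succ (fun j => (q.τ j • y j).1)]
      simp only [hy, hz, hx, Fin.cons_zero, Fin.cons_succ, Prod.smul_fst, smul_eq_mul, perspCap,
        modeGain_zero, mul_one]
      congr 1
      · rw [div_right_comm]
      · refine Finset.sum_congr rfl fun j _ => ?_
        congr 2; ring
    · rw [Prod.snd_sum, Prod.fst_sum]; rfl
    · rw [Prod.snd_sum, Prod.snd_sum]; rfl

/-- Lagrange multipliers for the optimal rate. -/
lemma exists_multipliers {a b σ P Q C : ℝ} (hσ : 0 < σ) (hP : 0 < P) (hQ : 0 < Q)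
    (hC : ∀ t ∈ convexHull ℝ (modeTriples a b σ), t.2.1 ≤ P → t.2.2 ≤ Q → t.1 ≤ C) :
    ∃ μ ν : ℝ, 0 < μ ∧ 0 ≤ ν ∧ ∀ (x : ℝ) (z : ℂ), 0 ≤ x →
      gaussCap (x / σ ^ 2 * modeGain a b z) ≤
        C + μ * (x - P) + ν * (‖z‖ ^ 2 * (a ^ 2 * x + σ ^ 2) - Q) := by
  set K := convexHull ℝ (modeTriples a b σ) with hK
  have h0K : (0, 0, 0) ∈ K := subset_convexHull ℝ _ (zero_mem_modeTriples a b σ)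
  have hC0 : 0 ≤ C := hC _ h0K hP.le hQ.le
  -- Triples strictly worse than a point of the hull in all coordinates. Openness allows the
  -- separation, and the unbounded directions of U fix the signs of the functional.
  set U : Set (ℝ × ℝ × ℝ) := {u | ∃ t ∈ K, u.1 < t.1 ∧ t.2.1 < u.2.1 ∧ t.2.2 < u.2.2} with hU
  have hUopen : IsOpen U := by
    have : U = ⋃ t ∈ K, {u : ℝ × ℝ × ℝ | u.1 < t.1 ∧ t.2.1 < u.2.1 ∧ t.2.2 < u.2.2} := by
      ext u; simp only [hU, Set.mem_ofPred_eq, Set.mem_iUnion, exists_prop]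
    rw [this]
    refine isOpen_biUnion fun t _ => ?_
    exact (isOpen_lt continuous_fst continuous_const).inter
      ((isOpen_lt continuous_const (continuous_fst.comp continuous_snd)).inter
        (isOpen_lt continuous_const (continuous_snd.comp continuous_snd)))
  have hUconv : Convex ℝ U := by
    rintro u ⟨t, ht, h1, h2, h3⟩ u' ⟨t', ht', h1', h2', h3'⟩ α β hα hβ hαβ
    refine ⟨α • t + β • t', (convex_convexHull ℝ _) ht ht' hα hβ hαβ, ?_, ?_, ?_⟩ <;>
    · simp only [Prod.fst_add, Prod.snd_add, Prod.smul_fst, Prod.smul_snd, smul_eq_mul]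
      rcases hα.eq_or_lt with h | h
      · have hβ1 : β = 1 := by linarith
        subst h; subst hβ1; linarith
      · have := mul_lt_mul_of_pos_left h1 h
        have := mul_lt_mul_of_pos_left h2 h
        have := mul_lt_mul_of_pos_left h3 h
        have := mul_le_mul_of_nonneg_left h1'.le hβ
        have := mul_le_mul_of_nonneg_left h2'.le hβ
        have := mul_le_mul_of_nonneg_left h3'.le hβ
        linarith
  have hnot : (C, P, Q) ∉ U := by
    rintro ⟨t, ht, h1, h2, h3⟩
    exact absurd (hC t ht h2.le h3.le) (not_le.2 h1)
  obtain ⟨f, hf⟩ := geometric_hahn_banach_open_point hUconv hUopen hnot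
  set α := f (1, 0, 0) with hα
  set β := f (0, 1, 0) with hβ
  set δ := f (0, 0, 1) with hδ
  have hfe : ∀ u : ℝ × ℝ × ℝ, f u = α * u.1 + β * u.2.1 + δ * u.2.2 := by
    intro u
    have : u = u.1 • ((1, 0, 0) : ℝ × ℝ × ℝ) + u.2.1 • ((0, 1, 0) : ℝ × ℝ × ℝ) +
        u.2.2 • ((0, 0, 1) : ℝ × ℝ × ℝ) := by
      refine Prod.ext ?_ (Prod.ext ?_ ?_) <;> simp
    conv_lhs => rw [this]
    rw [map_add, map_add, map_smul, map_smul, map_smul, smul_eq_mul, smul_eq_mul, smul_eq_mul]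
    ring
  simp only [hfe] at hf
  have hquad : ∀ p c : ℝ, 0 < p → 0 < c → α * (-1) + β * p + δ * c < α * C + β * P + δ * Q :=
    fun p c hp hc => hf (-1, p, c) ⟨_, h0K, by norm_num, hp, hc⟩
  -- Slater's condition: since P and Q are positive, the zero triple is strictly feasible, so the
  -- rate coefficient is not zero.
  have hα0 : 0 < α := by
    have := hquad P Q hP hQ
    have h2 : 0 < α * (C + 1) := by linarith
    exact pos_of_mul_pos_left h2 (by linarith)
  have hβ0 : β ≤ 0 := by
    by_contra hpos
    push Not at hpos
    have h1 := hquad (P + (α * C + α) / β) Q (by positivity) hQ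
    have h2 : β * ((α * C + α) / β) = α * C + α := mul_div_cancel₀ _ hpos.ne'
    nlinarith
  have hδ0 : δ ≤ 0 := by
    by_contra hpos
    push Not at hpos
    have h1 := hquad P (Q + (α * C + α) / δ) hP (by positivity)
    have h2 : δ * ((α * C + α) / δ) = α * C + α := mul_div_cancel₀ _ hpos.ne'
    nlinarith
  have hmain : ∀ (x : ℝ) (z : ℂ), 0 ≤ x → gaussCap (x / σ ^ 2 * modeGain a b z) ≤
        C + (-β / α) * (x - P) + (-δ / α) * (‖z‖ ^ 2 * (a ^ 2 * x + σ ^ 2) - Q) := by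
    intro x z hx
    set R := gaussCap (x / σ ^ 2 * modeGain a b z)
    set c := ‖z‖ ^ 2 * (a ^ 2 * x + σ ^ 2)
    have hmem : (R, x, c) ∈ K := subset_convexHull ℝ _ ⟨x, z, hx, rfl⟩
    have h1 : α * R + β * x + δ * c ≤ α * C + β * P + δ * Q := by
      refine le_of_forall_pos_le_add fun ε hε => ?_
      set s := ε / (α - β - δ)
      have hden : 0 < α - β - δ := by linarith
      have hs : 0 < s := div_pos hε hden
      have h2 := hf (R - s, x + s, c + s) ⟨_, hmem, by simpa using hs, by simpa using hs,
        by simpa using hs⟩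
      have h3 : s * (α - β - δ) = ε := div_mul_cancel₀ _ hden.ne'
      simp only at h2
      nlinarith
    have h2 : C + (-β / α) * (x - P) + (-δ / α) * (c - Q) - R =
        ((α * C + β * P + δ * Q) - (α * R + β * x + δ * c)) / α := by
      field_simp; ring
    have h3 : 0 ≤ ((α * C + β * P + δ * Q) - (α * R + β * x + δ * c)) / α :=
      div_nonneg (by linarith) hα0.le
    linarith
  have hν0 : 0 ≤ -δ / α := div_nonneg (by linarith) hα0.le
  refine ⟨-β / α, -δ / α, ?_, hν0, hmain⟩
  refine lt_of_le_of_ne (div_nonneg (by linarith) hα0.le) fun h => ?_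
  -- If μ were zero, a mode without relay whose source power gives rate C + 1 would violate the
  -- bound.
  have h1 := hmain (σ ^ 2 * (Real.exp (2 * (C + 1)) - 1)) 0 (by
    have := Real.add_one_le_exp (2 * (C + 1))
    have : 0 ≤ Real.exp (2 * (C + 1)) - 1 := by linarith
    positivity)
  rw [← h, modeGain_zero, gaussCap, mul_one, mul_div_cancel_left₀ _ (by positivity),
    add_sub_cancel, Real.log_exp] at h1
  simp only [norm_zero] at h1
  have := mul_nonneg hν0 hQ.le
  nlinarith

/-- Relay power that is not needed can be spent in a free mode of vanishing bandwidth. -/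
lemma exists_modes_relayPower_eq {m : ℕ} {a b σ P Q : ℝ} (hσ : 0 < σ) (hP : 0 ≤ P)
    {q : Modes (m + 1)} (hq : q.IsValid) (hτ : q.τ (Fin.last (m + 1)) = 0)
    (hθ : q.θ (Fin.last (m + 1)) = 0) (hQ : q.relayPower a σ P ≤ Q) {ε : ℝ} (hε0 : 0 < ε)
    (hε1 : ε < 1) : ∃ q' : Modes (m + 1), q'.IsValid ∧ q'.relayPower a σ P = Q ∧
      (1 - ε) * q.rate a b σ P ≤ q'.rate a b σ P := by
  have hs0 : 0 < 1 - ε := by linarith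
  -- D is the relay power left after the other bands shrink by 1 - ε. In a band ε without source
  -- power the relay forwards only its noise, so a gain √(D / (ε σ²)) spends exactly D.
  set D := Q - ∑ j : Fin m, ‖q.gain j.castSucc‖ ^ 2 *
    (a ^ 2 * q.θ j.castSucc.succ * P + (1 - ε) * q.τ j.castSucc.succ * σ ^ 2) with hD
  have hlast : (Fin.last m).succ = Fin.last (m + 1) := Fin.succ_last m
  have hD0 : 0 ≤ D := by
    rw [hD, sub_nonneg]
    refine le_trans ?_ hQ
    rw [Modes.relayPower, Fin.sum_univ_castSucc, hlast, hτ, hθ]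
    simp only [mul_zero, zero_mul, add_zero]
    refine Finset.sum_le_sum fun j _ => ?_
    have h1 := mul_nonneg (hq.τ_nonneg j.castSucc.succ) (sq_nonneg σ)
    refine mul_le_mul_of_nonneg_left ?_ (by positivity)
    nlinarith
  have hne : ∀ j : Fin (m + 1), j.castSucc ≠ Fin.last (m + 1) := fun j => Fin.castSucc_ne_last j
  set q' : Modes (m + 1) :=
    ⟨Fin.snoc (fun j : Fin (m + 1) => (1 - ε) * q.τ j.castSucc) ε, q.θ,
      Fin.snoc (fun j : Fin m => q.gain j.castSucc) ((√(D / (ε * σ ^ 2)) : ℝ) : ℂ)⟩ with hq'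
  have hτc : ∀ j : Fin (m + 1), q'.τ j.castSucc = (1 - ε) * q.τ j.castSucc := fun j => by
    simp [hq']
  have hτl : q'.τ (Fin.last (m + 1)) = ε := by simp [hq']
  have hgc : ∀ j : Fin m, q'.gain j.castSucc = q.gain j.castSucc := fun j => by simp [hq']
  have hgl : q'.gain (Fin.last m) = ((√(D / (ε * σ ^ 2)) : ℝ) : ℂ) := by simp [hq']
  have hsc : ∀ j : Fin m, j.castSucc.succ = j.succ.castSucc := fun j => Fin.succ_castSucc j
  refine ⟨q', ⟨?_, hq.θ_nonneg, ?_, hq.sum_θ⟩, ?_, ?_⟩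
  · refine Fin.lastCases ?_ fun j => ?_
    · rw [hτl]; exact hε0.le
    · rw [hτc]; exact mul_nonneg hs0.le (hq.τ_nonneg _)
  · have h1 := hq.sum_τ
    rw [Fin.sum_univ_castSucc, hτ, add_zero] at h1
    rw [Fin.sum_univ_castSucc, hτl]
    simp only [hτc]
    rw [← Finset.mul_sum, h1]; ring
  · rw [Modes.relayPower, Fin.sum_univ_castSucc, hlast, hτl, hgl]
    simp only [hgc, hsc, hτc]
    rw [show q'.θ = q.θ from rfl, hθ, Complex.norm_real, Real.norm_eq_abs, sq_abs,
      Real.sq_sqrt (by positivity)]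
    have : D / (ε * σ ^ 2) * (a ^ 2 * 0 * P + ε * σ ^ 2) = D := by
      field_simp; ring
    rw [this, hD]
    simp only [hsc]
    ring
  · rw [Modes.rate_eq, Modes.rate_eq, mul_add, Finset.mul_sum, Fin.sum_univ_castSucc,
      Fin.sum_univ_castSucc, hlast, hτ, hθ, perspCap_zero_left, mul_zero, add_zero]
    have hz : (0 : Fin (m + 2)) = (0 : Fin (m + 1)).castSucc := rfl
    have hθ0 := hq.θ_nonneg
    refine add_le_add ?_ (le_trans (Finset.sum_le_sum fun j _ => ?_) (le_add_of_nonneg_right ?_))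
    · rw [hz, hτc]
      exact mul_perspCap_le (hq.τ_nonneg _)
        (div_nonneg (mul_nonneg (hθ0 _) hP) (by positivity)) hs0 (by linarith)
    · rw [hsc, hτc, hgc]
      exact mul_perspCap_le (hq.τ_nonneg _) (mul_nonneg
        (div_nonneg (mul_nonneg (hθ0 _) hP) (by positivity)) (modeGain_nonneg _ _ _)) hs0
        (by linarith)
    · rw [hτl]
      exact perspCap_nonneg hε0.le (by simp)

section

open Matrix

/-! ### Centred Gaussian vectors: linear images, second moments, densities. -/

section GaussianLaws

variable {n : ℕ}

lemma posSemidef_mul_mul_transpose {S : Matrix (Fin n) (Fin n) ℝ} (hS : S.PosSemidef)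
    (T : Matrix (Fin n) (Fin n) ℝ) : (T * S * Tᵀ).PosSemidef := by
  have := hS.mul_mul_conjTranspose_same T
  rwa [conjTranspose_eq_transpose_of_trivial] at this

lemma inner_toEuclideanCLM_left (T : Matrix (Fin n) (Fin n) ℝ) (x t : Block n) :
    inner ℝ (toEuclideanCLM (𝕜 := ℝ) T x) t = inner ℝ x (toEuclideanCLM (𝕜 := ℝ) Tᵀ t) := by
  rw [real_inner_comm, inner_toEuclideanCLM, inner_toEuclideanCLM, dotProduct_mulVec,
    ← mulVec_transpose, dotProduct_comm]

lemma charFun_map_toEuclideanCLM (μ : Measure (Block n)) (T : Matrix (Fin n) (Fin n) ℝ)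
    (t : Block n) : charFun (μ.map (toEuclideanCLM (𝕜 := ℝ) T)) t =
      charFun μ (toEuclideanCLM (𝕜 := ℝ) Tᵀ t) := by
  rw [charFun_apply, charFun_apply, integral_map (by fun_prop)
    (Measurable.aestronglyMeasurable (by fun_prop))]
  simp only [inner_toEuclideanCLM_left]

/-- Linear images of centred Gaussian vectors. -/
lemma map_toEuclideanCLM_multivariateGaussian {S : Matrix (Fin n) (Fin n) ℝ} (hS : S.PosSemidef)
    (T : Matrix (Fin n) (Fin n) ℝ) :
    (multivariateGaussian 0 S).map (toEuclideanCLM (𝕜 := ℝ) T) =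
      multivariateGaussian 0 (T * S * Tᵀ) := by
  apply Measure.ext_of_charFun
  ext t
  rw [charFun_map_toEuclideanCLM, charFun_multivariateGaussian hS,
    charFun_multivariateGaussian (posSemidef_mul_mul_transpose hS T)]
  congr 3
  · simp
  · rw [ofLp_toEuclideanCLM, ← mulVec_mulVec, ← mulVec_mulVec, dotProduct_mulVec t.ofLp T,
      ← mulVec_transpose]

/-- Sums of independent centred Gaussian vectors. -/
lemma map_add_multivariateGaussian {S₁ S₂ : Matrix (Fin n) (Fin n) ℝ} (h₁ : S₁.PosSemidef)
    (h₂ : S₂.PosSemidef) :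
    ((multivariateGaussian 0 S₁).prod (multivariateGaussian 0 S₂)).map (fun p => p.1 + p.2) =
      multivariateGaussian 0 (S₁ + S₂) := by
  apply Measure.ext_of_charFun
  ext t
  have := charFun_map_add_prod_eq_mul (μ := multivariateGaussian 0 S₁)
    (ν := multivariateGaussian 0 S₂)
  have h := congrFun this t
  rw [h, Pi.mul_apply, charFun_multivariateGaussian h₁, charFun_multivariateGaussian h₂,
    charFun_multivariateGaussian (h₁.add h₂), ← Complex.exp_add, add_mulVec, dotProduct_add]
  congr 1
  simp
  ring

lemma map_mulVec_add_multivariateGaussian {S₁ S₂ : Matrix (Fin n) (Fin n) ℝ}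
    (h₁ : S₁.PosSemidef) (h₂ : S₂.PosSemidef) (T : Matrix (Fin n) (Fin n) ℝ) :
    ((multivariateGaussian 0 S₁).prod (multivariateGaussian 0 S₂)).map
        (fun p => toEuclideanCLM (𝕜 := ℝ) T p.1 + p.2) =
      multivariateGaussian 0 (T * S₁ * Tᵀ + S₂) := by
  rw [← map_add_multivariateGaussian (posSemidef_mul_mul_transpose h₁ T) h₂,
    ← map_toEuclideanCLM_multivariateGaussian h₁ T]
  have h3 := Measure.map_prod_map (multivariateGaussian 0 S₁) (multivariateGaussian 0 S₂)
    (f := toEuclideanCLM (𝕜 := ℝ) T) (g := id) (by fun_prop) measurable_id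
  rw [Measure.map_id] at h3
  rw [h3, Measure.map_map (by fun_prop) (by fun_prop)]
  rfl

/-- Second moment of a centred Gaussian vector. -/
lemma integrable_norm_sq_multivariateGaussian (S : Matrix (Fin n) (Fin n) ℝ) :
    Integrable (fun x => ‖x‖ ^ 2) (multivariateGaussian 0 S) :=
  (IsGaussian.memLp_two_id (μ := multivariateGaussian (0 : Block n) S)).integrable_norm_pow
    two_ne_zero

lemma integral_norm_sq_multivariateGaussian {S : Matrix (Fin n) (Fin n) ℝ} (hS : S.PosSemidef) :
    ∫ x, ‖x‖ ^ 2 ∂(multivariateGaussian 0 S) = S.trace := by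
  have hmem : ∀ i, MemLp (fun x : Block n => x i) 2 (multivariateGaussian 0 S) := fun i =>
    (EuclideanSpace.proj (𝕜 := ℝ) i).comp_memLp'
      (IsGaussian.memLp_two_id (μ := multivariateGaussian (0 : Block n) S))
  have hmean : ∀ i, ∫ x : Block n, x i ∂(multivariateGaussian 0 S) = 0 := by
    intro i
    have := (EuclideanSpace.proj (𝕜 := ℝ) i).integral_comp_comm
      (IsGaussian.integrable_fun_id (μ := multivariateGaussian (0 : Block n) S))
    rw [integral_id_multivariateGaussian] at this
    simpa using this
  have hvar : ∀ i, ∫ x : Block n, x i ^ 2 ∂(multivariateGaussian 0 S) = S i i := by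
    intro i
    rw [← variance_eval_multivariateGaussian (μ := 0) hS i,
      variance_of_integral_eq_zero (hmem i).aemeasurable (hmean i)]
  simp only [EuclideanSpace.real_norm_sq_eq]
  rw [integral_finsetSum _ fun i _ => (hmem i).integrable_sq]
  simp only [hvar]
  rfl

/-- The standard Gaussian density. -/
def stdDensity (n : ℕ) (x : Block n) : ℝ :=
  ((2 * Real.pi) ^ ((n : ℝ) / 2))⁻¹ * Real.exp (-(1 / 2) * ‖x‖ ^ 2)

lemma stdDensity_pos (x : Block n) : 0 < stdDensity n x := by
  have := Real.pi_pos
  unfold stdDensity; positivity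

@[fun_prop]
lemma continuous_stdDensity : Continuous (stdDensity n) := by
  unfold stdDensity; fun_prop

lemma integrable_stdDensity : Integrable (stdDensity n) := by
  unfold stdDensity
  apply Integrable.const_mul
  have h := (GaussianFourier.integrable_cexp_neg_mul_sq_norm_add (V := Block n) (b := 1 / 2)
    (by norm_num) 0 0).norm
  refine h.congr (Eventually.of_forall fun x => ?_)
  simp only [zero_mul, add_zero]
  rw [Complex.norm_exp]
  congr 1
  have : (-(1 / 2 : ℂ) * (‖x‖ : ℂ) ^ 2) = ((-(1 / 2) * ‖x‖ ^ 2 : ℝ) : ℂ) := by push_cast; ring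
  rw [this, Complex.ofReal_re]

lemma stdGaussian_eq_withDensity :
    stdGaussian (Block n) = volume.withDensity fun x => ENNReal.ofReal (stdDensity n x) := by
  have hfin : IsFiniteMeasure
      (volume.withDensity fun x : Block n => ENNReal.ofReal (stdDensity n x)) :=
    isFiniteMeasure_withDensity_ofReal integrable_stdDensity.2
  apply Measure.ext_of_charFun
  ext t
  rw [charFun_stdGaussian, charFun_apply,
    integral_withDensity_eq_integral_toReal_smul (by fun_prop)
      (Eventually.of_forall fun x => ENNReal.ofReal_lt_top)]
  have h1 : ∀ x : Block n, (ENNReal.ofReal (stdDensity n x)).toReal •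
      Complex.exp ((inner ℝ x t : ℝ) * Complex.I) =
      (((2 * Real.pi) ^ ((n : ℝ) / 2))⁻¹ : ℝ) *
        Complex.exp (-(1 / 2 : ℂ) * (‖x‖ : ℂ) ^ 2 + Complex.I * (inner ℝ t x : ℝ)) := by
    intro x
    rw [ENNReal.toReal_ofReal (stdDensity_pos x).le, stdDensity, Complex.exp_add,
      real_inner_comm, Complex.real_smul]
    push_cast
    ring_nf
  simp only [h1]
  rw [integral_const_mul, GaussianFourier.integral_cexp_neg_mul_sq_norm_add (by norm_num)]
  have h2 : ((Real.pi : ℂ) / (1 / 2)) ^ ((Module.finrank ℝ (Block n) : ℂ) / 2) =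
      (((2 * Real.pi) ^ ((n : ℝ) / 2) : ℝ) : ℂ) := by
    rw [Complex.ofReal_cpow (by positivity)]
    congr 1
    · push_cast; ring
    · simp
  rw [h2, ← mul_assoc, ← Complex.ofReal_mul, inv_mul_cancel₀ (by positivity), Complex.ofReal_one,
    one_mul, Complex.I_sq]
  congr 1
  ring

/-- The density of the Gaussian vector with covariance `B Bᵀ`. -/
def gaussDensity (B : Matrix (Fin n) (Fin n) ℝ) (y : Block n) : ℝ :=
  |B.det|⁻¹ * stdDensity n (toEuclideanCLM (𝕜 := ℝ) B⁻¹ y)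

lemma gaussDensity_pos {B : Matrix (Fin n) (Fin n) ℝ} (hB : B.det ≠ 0) (y : Block n) :
    0 < gaussDensity B y := by
  have := stdDensity_pos (toEuclideanCLM (𝕜 := ℝ) B⁻¹ y)
  unfold gaussDensity; positivity

@[fun_prop]
lemma continuous_gaussDensity (B : Matrix (Fin n) (Fin n) ℝ) : Continuous (gaussDensity B) := by
  unfold gaussDensity; fun_prop

lemma log_gaussDensity {B : Matrix (Fin n) (Fin n) ℝ} (hB : B.det ≠ 0) (y : Block n) :
    Real.log (gaussDensity B y) = -Real.log |B.det| - Real.log ((2 * Real.pi) ^ ((n : ℝ) / 2)) -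
      1 / 2 * ‖toEuclideanCLM (𝕜 := ℝ) B⁻¹ y‖ ^ 2 := by
  have := Real.pi_pos
  unfold gaussDensity stdDensity
  rw [Real.log_mul (by positivity) (by positivity), Real.log_mul (by positivity) (by positivity),
    Real.log_inv, Real.log_inv, Real.log_exp]
  ring

lemma det_toEuclideanCLM (B : Matrix (Fin n) (Fin n) ℝ) :
    LinearMap.det (toEuclideanCLM (𝕜 := ℝ) B : Block n →ₗ[ℝ] Block n) = B.det := by
  rw [coe_toEuclideanCLM_eq_toEuclideanLin, toEuclideanLin_eq_toLin_orthonormal,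
    LinearMap.det_toLin]

/-- The law is the image of the standard Gaussian under B, and the change of variables contributes
|det B|⁻¹. -/
lemma multivariateGaussian_eq_withDensity {B N : Matrix (Fin n) (Fin n) ℝ} (hB : B.det ≠ 0)
    (hN : B * Bᵀ = N) : multivariateGaussian 0 N =
      volume.withDensity fun y => ENNReal.ofReal (gaussDensity B y) := by
  have hunit : IsUnit B.det := isUnit_iff_ne_zero.2 hB
  have h1 : multivariateGaussian 0 N =
      (stdGaussian (Block n)).map (toEuclideanCLM (𝕜 := ℝ) B) := by
    rw [← multivariateGaussian_zero_one, map_toEuclideanCLM_multivariateGaussian PosSemidef.one,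
      mul_one, hN]
  have hinv : ∀ x : Block n,
      toEuclideanCLM (𝕜 := ℝ) B⁻¹ (toEuclideanCLM (𝕜 := ℝ) B x) = x := by
    intro x
    rw [← mul_apply_eq_comp, ← map_mul, nonsing_inv_mul _ hunit, map_one]; rfl
  rw [h1, stdGaussian_eq_withDensity]
  refine Measure.ext_of_lintegral _ fun f hf => ?_
  rw [lintegral_map hf (by fun_prop),
    lintegral_withDensity_eq_lintegral_mul _ (by fun_prop) (by fun_prop),
    lintegral_withDensity_eq_lintegral_mul _ (by fun_prop) hf]
  have h2 := Measure.map_linearMap_addHaar_eq_smul_addHaar (μ := (volume : Measure (Block n)))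
    (f := (toEuclideanCLM (𝕜 := ℝ) B : Block n →ₗ[ℝ] Block n)) (by rw [det_toEuclideanCLM]; exact hB)
  rw [det_toEuclideanCLM] at h2
  have h3 := lintegral_map (μ := (volume : Measure (Block n)))
    (f := fun y => ENNReal.ofReal (stdDensity n (toEuclideanCLM (𝕜 := ℝ) B⁻¹ y)) * f y)
    (g := (toEuclideanCLM (𝕜 := ℝ) B : Block n →ₗ[ℝ] Block n)) (by fun_prop)
    (show Measurable (toEuclideanCLM (𝕜 := ℝ) B) by fun_prop)
  rw [h2, lintegral_smul_measure] at h3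
  simp only [Pi.mul_apply]
  have h4 : ∀ x, (toEuclideanCLM (𝕜 := ℝ) B : Block n →ₗ[ℝ] Block n) x =
    toEuclideanCLM (𝕜 := ℝ) B x := fun x => rfl
  simp only [h4, hinv] at h3
  rw [← h3, smul_eq_mul, ← lintegral_const_mul _ (by fun_prop)]
  refine lintegral_congr fun y => ?_
  rw [gaussDensity, ENNReal.ofReal_mul (by positivity), abs_inv, mul_assoc]

end GaussianLaws

/-! ### Mutual information and relay power of the Gaussian channel. -/

section MutualInformation

/-- Divergence from a measure with respect to which there is a positive real density. -/
lemma klDiv_withDensity_ofReal {α : Type*} [MeasurableSpace α] (ν : Measure α)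
    [IsProbabilityMeasure ν] {F : α → ℝ} (hF : Measurable F) (hpos : ∀ x, 0 < F x)
    [IsProbabilityMeasure (ν.withDensity fun x => ENNReal.ofReal (F x))]
    (hint : Integrable (fun x => Real.log (F x))
      (ν.withDensity fun x => ENNReal.ofReal (F x))) :
    InformationTheory.klDiv (ν.withDensity fun x => ENNReal.ofReal (F x)) ν =
      ENNReal.ofReal (∫ x, Real.log (F x) ∂(ν.withDensity fun x => ENNReal.ofReal (F x))) := by
  set J := ν.withDensity fun x => ENNReal.ofReal (F x) with hJ
  have hac : J ≪ ν := withDensity_absolutelyContinuous _ _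
  have hllr : llr J ν =ᵐ[J] fun x => Real.log (F x) := by
    have h1 : J.rnDeriv ν =ᵐ[ν] fun x => ENNReal.ofReal (F x) :=
      Measure.rnDeriv_withDensity ν hF.ennreal_ofReal
    filter_upwards [hac.ae_le h1] with x hx
    rw [llr, hx, ENNReal.toReal_ofReal (hpos x).le]
  rw [InformationTheory.klDiv_of_ac_of_integrable hac (hint.congr hllr.symm),
    integral_congr_ae hllr]
  simp

/-- The joint law of an input and its image under a channel with additive noise has a density
with respect to the product of the input law and any law with positive density. -/
lemma map_prod_add_eq_withDensity {n : ℕ} (μ : Measure (Block n)) [IsProbabilityMeasure μ]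
    {p q : Block n → ℝ} (hp : Measurable p) (hq : Measurable q)
    (hq0 : ∀ y, 0 < q y) {νp νq : Measure (Block n)}
    [IsProbabilityMeasure νp] [IsProbabilityMeasure νq]
    (hνp : νp = volume.withDensity fun y => ENNReal.ofReal (p y))
    (hνq : νq = volume.withDensity fun y => ENNReal.ofReal (q y))
    {T : Block n → Block n} (hT : Measurable T) :
    (μ.prod νp).map (fun z => (z.1, T z.1 + z.2)) =
      (μ.prod νq).withDensity fun z => ENNReal.ofReal (p (z.2 - T z.1) / q z.2) := by
  have hmeas : Measurable fun z : Block n × Block n =>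
      ENNReal.ofReal (p (z.2 - T z.1) / q z.2) := by fun_prop
  refine Measure.ext_of_lintegral _ fun f hf => ?_
  rw [lintegral_map hf (by fun_prop), lintegral_withDensity_eq_lintegral_mul _ hmeas hf,
    lintegral_prod _ (by fun_prop), lintegral_prod _ (by fun_prop)]
  refine lintegral_congr fun x => ?_
  rw [hνp, hνq, lintegral_withDensity_eq_lintegral_mul _ (by fun_prop) (by fun_prop),
    lintegral_withDensity_eq_lintegral_mul _ (by fun_prop) (by fun_prop)]
  simp only [Pi.mul_apply]
  rw [← lintegral_sub_right_eq_self (μ := (volume : Measure (Block n))) _ (T x)]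
  refine lintegral_congr fun y => ?_
  rw [add_sub_cancel, ← mul_assoc, ← ENNReal.ofReal_mul (hq0 y).le]
  congr 2
  have := (hq0 y).ne'
  field_simp

variable {n : ℕ}

lemma exists_sqrt_factor {N : Matrix (Fin n) (Fin n) ℝ} (hN : N.PosDef) :
    ∃ B : Matrix (Fin n) (Fin n) ℝ, B * Bᵀ = N ∧ B.det ≠ 0 ∧
      Real.log |B.det| = 1 / 2 * Real.log N.det := by
  obtain ⟨B, hB⟩ : ∃ B : Matrix (Fin n) (Fin n) ℝ, N = Bᴴ * B := by
    open scoped MatrixOrder in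
    exact CStarAlgebra.nonneg_iff_eq_star_mul_self.1 hN.posSemidef.nonneg
  rw [conjTranspose_eq_transpose_of_trivial] at hB
  have hdet : N.det = B.det ^ 2 := by rw [hB, det_mul, det_transpose, sq]
  have hne : B.det ≠ 0 := fun h => by
    have := hN.det_pos
    rw [hdet, h] at this
    simp at this
  refine ⟨Bᵀ, by rw [transpose_transpose, hB], by rwa [det_transpose], ?_⟩
  rw [det_transpose, hdet, Real.log_pow, Real.log_abs]
  push_cast; ring

lemma integral_norm_sq_whitened {B N : Matrix (Fin n) (Fin n) ℝ} (hN : N.PosSemidef)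
    (hB : B.det ≠ 0) (hBN : B * Bᵀ = N) :
    Integrable (fun w => ‖toEuclideanCLM (𝕜 := ℝ) B⁻¹ w‖ ^ 2) (multivariateGaussian 0 N) ∧
      ∫ w, ‖toEuclideanCLM (𝕜 := ℝ) B⁻¹ w‖ ^ 2 ∂(multivariateGaussian 0 N) = n := by
  have hunit : IsUnit B.det := isUnit_iff_ne_zero.2 hB
  have h1 : B⁻¹ * N * B⁻¹ᵀ = 1 := by
    rw [← hBN, ← Matrix.mul_assoc, nonsing_inv_mul _ hunit, one_mul, ← transpose_mul,
      nonsing_inv_mul _ hunit, transpose_one]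
  have h2 := map_toEuclideanCLM_multivariateGaussian hN B⁻¹
  rw [h1] at h2
  have hint := integrable_norm_sq_multivariateGaussian (1 : Matrix (Fin n) (Fin n) ℝ)
  have hval := integral_norm_sq_multivariateGaussian (PosSemidef.one (n := Fin n) (R := ℝ))
  rw [← h2] at hint hval
  rw [integrable_map_measure (by fun_prop) (by fun_prop)] at hint
  rw [integral_map (by fun_prop) (by fun_prop)] at hval
  exact ⟨hint, by rw [hval]; simp⟩

/-- Divergence of the joint law of the Gaussian channel `y = T x + w` from the product law. -/
lemma klDiv_gaussian_channel {S N : Matrix (Fin n) (Fin n) ℝ} (hS : S.PosSemidef) (hN : N.PosDef)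
    (T : Matrix (Fin n) (Fin n) ℝ) :
    InformationTheory.klDiv
      (((multivariateGaussian 0 S).prod (multivariateGaussian 0 N)).map
        fun z => (z.1, toEuclideanCLM (𝕜 := ℝ) T z.1 + z.2))
      ((multivariateGaussian 0 S).prod (multivariateGaussian 0 (T * S * Tᵀ + N))) =
    ENNReal.ofReal (1 / 2 * Real.log ((T * S * Tᵀ + N).det / N.det)) := by
  have hY : (T * S * Tᵀ + N).PosDef := by
    rw [add_comm]; exact hN.add_posSemidef (posSemidef_mul_mul_transpose hS T)
  obtain ⟨B, hBN, hB0, hBlog⟩ := exists_sqrt_factor hN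
  obtain ⟨D, hDY, hD0, hDlog⟩ := exists_sqrt_factor hY
  set μ : Measure (Block n) := multivariateGaussian 0 S with hμ
  set νN : Measure (Block n) := multivariateGaussian 0 N with hνN
  set νY : Measure (Block n) := multivariateGaussian 0 (T * S * Tᵀ + N) with hνY
  have hTm : Measurable (toEuclideanCLM (𝕜 := ℝ) T) := by fun_prop
  -- S may be singular, so the input need not have a density. Only the densities of noise and output
  -- enter the likelihood ratio.
  have hjoint := map_prod_add_eq_withDensity μ (p := gaussDensity B) (q := gaussDensity D)
    (by fun_prop) (by fun_prop) (gaussDensity_pos hD0)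
    (multivariateGaussian_eq_withDensity hB0 hBN) (multivariateGaussian_eq_withDensity hD0 hDY) hTm
  rw [← hνN, ← hνY] at hjoint
  set F : Block n × Block n → ℝ := fun z =>
    gaussDensity B (z.2 - toEuclideanCLM (𝕜 := ℝ) T z.1) / gaussDensity D z.2 with hF
  have hFpos : ∀ z, 0 < F z := fun z => div_pos (gaussDensity_pos hB0 _) (gaussDensity_pos hD0 _)
  have hFmeas : Measurable F := by fun_prop
  have hprob : IsProbabilityMeasure ((μ.prod νN).map
      fun z => (z.1, toEuclideanCLM (𝕜 := ℝ) T z.1 + z.2)) :=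
    Measure.isProbabilityMeasure_map (by fun_prop)
  obtain ⟨hi1, hv1⟩ := integral_norm_sq_whitened hN.posSemidef hB0 hBN
  obtain ⟨hi2, hv2⟩ := integral_norm_sq_whitened hY.posSemidef hD0 hDY
  have hlaw : (μ.prod νN).map (fun z => toEuclideanCLM (𝕜 := ℝ) T z.1 + z.2) = νY :=
    map_mulVec_add_multivariateGaussian hS hN.posSemidef T
  -- Each whitened squared norm has mean n, so the quadratic terms cancel in expectation and the
  -- log-determinant constant remains.
  have hlogF : ∀ z : Block n × Block n, Real.log (F (z.1, toEuclideanCLM (𝕜 := ℝ) T z.1 + z.2)) =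
      1 / 2 * Real.log ((T * S * Tᵀ + N).det / N.det) -
        1 / 2 * ‖toEuclideanCLM (𝕜 := ℝ) B⁻¹ z.2‖ ^ 2 +
        1 / 2 * ‖toEuclideanCLM (𝕜 := ℝ) D⁻¹ (toEuclideanCLM (𝕜 := ℝ) T z.1 + z.2)‖ ^ 2 := by
    intro z
    simp only [hF, add_sub_cancel_left]
    rw [Real.log_div (gaussDensity_pos hB0 _).ne' (gaussDensity_pos hD0 _).ne',
      log_gaussDensity hB0, log_gaussDensity hD0, hBlog, hDlog,
      Real.log_div hY.det_pos.ne' hN.det_pos.ne']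
    ring
  have hI1 : Integrable (fun z : Block n × Block n => ‖toEuclideanCLM (𝕜 := ℝ) B⁻¹ z.2‖ ^ 2)
      (μ.prod νN) := hi1.comp_snd μ
  have hI2 : Integrable (fun z : Block n × Block n =>
      ‖toEuclideanCLM (𝕜 := ℝ) D⁻¹ (toEuclideanCLM (𝕜 := ℝ) T z.1 + z.2)‖ ^ 2) (μ.prod νN) := by
    rw [← hνY, ← hlaw, integrable_map_measure (by fun_prop) (by fun_prop)] at hi2
    exact hi2
  have hV1 : ∫ z, ‖toEuclideanCLM (𝕜 := ℝ) B⁻¹ z.2‖ ^ 2 ∂(μ.prod νN) = n := by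
    rw [← hv1, integral_fun_snd (μ := μ) (ν := νN)
      (fun w => ‖toEuclideanCLM (𝕜 := ℝ) B⁻¹ w‖ ^ 2)]
    simp [hνN]
  have hV2 : ∫ z, ‖toEuclideanCLM (𝕜 := ℝ) D⁻¹ (toEuclideanCLM (𝕜 := ℝ) T z.1 + z.2)‖ ^ 2
      ∂(μ.prod νN) = n := by
    rw [← hνY, ← hlaw, integral_map (by fun_prop) (by fun_prop)] at hv2
    exact hv2
  have hint0 : Integrable (fun z : Block n × Block n =>
      Real.log (F (z.1, toEuclideanCLM (𝕜 := ℝ) T z.1 + z.2))) (μ.prod νN) := by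
    simp only [hlogF]
    exact ((integrable_const _).sub (hI1.const_mul _)).add (hI2.const_mul _)
  have hmeasmap : Measurable fun z : Block n × Block n =>
      (z.1, toEuclideanCLM (𝕜 := ℝ) T z.1 + z.2) := by fun_prop
  have hlogmeas : Measurable fun z => Real.log (F z) := by fun_prop
  have hint : Integrable (fun z => Real.log (F z)) ((μ.prod νN).map
      fun z => (z.1, toEuclideanCLM (𝕜 := ℝ) T z.1 + z.2)) := by
    rw [integrable_map_measure hlogmeas.aestronglyMeasurable hmeasmap.aemeasurable]
    exact hint0
  have hvalue : ∫ z, Real.log (F z) ∂((μ.prod νN).map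
      fun z => (z.1, toEuclideanCLM (𝕜 := ℝ) T z.1 + z.2)) =
      1 / 2 * Real.log ((T * S * Tᵀ + N).det / N.det) := by
    rw [integral_map hmeasmap.aemeasurable hlogmeas.aestronglyMeasurable]
    simp only [hlogF]
    rw [integral_add (f := fun z : Block n × Block n =>
        1 / 2 * Real.log ((T * S * Tᵀ + N).det / N.det) -
          1 / 2 * ‖toEuclideanCLM (𝕜 := ℝ) B⁻¹ z.2‖ ^ 2)
        ((integrable_const _).sub (hI1.const_mul _)) (hI2.const_mul _),
      integral_sub (integrable_const _) (hI1.const_mul _), integral_const_mul, integral_const_mul,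
      hV1, integral_const_mul, hV2]
    simp
  rw [← hvalue]
  rw [hjoint] at hprob hint ⊢
  exact klDiv_withDensity_ofReal (μ.prod νY) hFmeas hFpos hint

lemma toEuclideanCLM_smul_one (s : ℝ) (x : Block n) :
    toEuclideanCLM (𝕜 := ℝ) (s • (1 : Matrix (Fin n) (Fin n) ℝ)) x = s • x := by
  rw [map_smul, map_one]; rfl

lemma posSemidef_sq_smul_one (σ : ℝ) :
    (σ ^ 2 • (1 : Matrix (Fin n) (Fin n) ℝ)).PosSemidef :=
  PosSemidef.one.smul (sq_nonneg σ)

/-- The covariance of the total noise at the destination. -/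
def noiseCov (b σ : ℝ) (H : Matrix (Fin n) (Fin n) ℝ) : Matrix (Fin n) (Fin n) ℝ :=
  σ ^ 2 • (1 + b ^ 2 • (H * Hᵀ))

lemma posDef_noiseCov (b : ℝ) {σ : ℝ} (hσ : 0 < σ) (H : Matrix (Fin n) (Fin n) ℝ) :
    (noiseCov b σ H).PosDef := by
  have h := posSemidef_self_mul_conjTranspose H
  rw [conjTranspose_eq_transpose_of_trivial] at h
  exact (PosDef.one.add_posSemidef (h.smul (sq_nonneg b))).smul (by positivity)

/-- The mutual information between the source block and the destination block. -/
theorem mutualInfo_eq (a b : ℝ) {σ : ℝ} (hσ : 0 < σ) {S : Matrix (Fin n) (Fin n) ℝ}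
    (hS : S.PosSemidef) (H : Matrix (Fin n) (Fin n) ℝ) :
    mutualInfo (blockLaw σ S) sourceSent (destReceived a b H) =
      ENNReal.ofReal (1 / 2 * Real.log (((1 + (a * b) • H) * S * (1 + (a * b) • H)ᵀ +
        noiseCov b σ H).det / (noiseCov b σ H).det)) := by
  set T : Matrix (Fin n) (Fin n) ℝ := 1 + (a * b) • H with hT
  set μ : Measure (Block n) := multivariateGaussian 0 S with hμ
  set ν : Measure (Block n) :=
    multivariateGaussian 0 (σ ^ 2 • (1 : Matrix (Fin n) (Fin n) ℝ)) with hν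
  have hw : (ν.prod ν).map (fun p => toEuclideanCLM (𝕜 := ℝ) (b • H) p.1 + p.2) =
      multivariateGaussian 0 (noiseCov b σ H) := by
    rw [hν, map_mulVec_add_multivariateGaussian (posSemidef_sq_smul_one σ)
      (posSemidef_sq_smul_one σ)]
    congr 1
    simp only [noiseCov, transpose_smul, Matrix.mul_smul, mul_one, Matrix.smul_mul, smul_smul,
      smul_add]
    rw [add_comm]
    congr 2
    ring
  have hdest : ∀ ω : Block n × Block n × Block n, destReceived a b H ω =
      toEuclideanCLM (𝕜 := ℝ) T ω.1 + (toEuclideanCLM (𝕜 := ℝ) (b • H) ω.2.1 + ω.2.2) := by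
    intro ω
    simp only [destReceived, sourceSent, relaySent, relayReceived, hT, map_add, map_smul, map_one,
      _root_.add_apply, _root_.smul_apply,
      one_apply_eq_self, smul_add, smul_smul]
    rw [mul_comm b a]
    abel
  have hprod : (blockLaw σ S).map (fun ω => (ω.1,
      toEuclideanCLM (𝕜 := ℝ) (b • H) ω.2.1 + ω.2.2)) =
      μ.prod (multivariateGaussian 0 (noiseCov b σ H)) := by
    have h3 := Measure.map_prod_map μ (ν.prod ν) (f := id)
      (g := fun p => toEuclideanCLM (𝕜 := ℝ) (b • H) p.1 + p.2) measurable_id (by fun_prop)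
    rw [Measure.map_id, hw] at h3
    rw [h3]; rfl
  have hjoint : (blockLaw σ S).map (fun ω => (sourceSent ω, destReceived a b H ω)) =
      (μ.prod (multivariateGaussian 0 (noiseCov b σ H))).map
        fun z => (z.1, toEuclideanCLM (𝕜 := ℝ) T z.1 + z.2) := by
    rw [← hprod, Measure.map_map (by fun_prop) (by fun_prop)]
    congr 1
    funext ω
    simp only [hdest, Function.comp_apply, sourceSent]
  have hx : (blockLaw σ S).map sourceSent = μ := by
    have h4 : (blockLaw σ S).map Prod.fst = μ := by
      rw [blockLaw, Measure.map_fst_prod]; simp [hμ]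
    exact h4
  have hy : (blockLaw σ S).map (destReceived a b H) =
      multivariateGaussian 0 (T * S * Tᵀ + noiseCov b σ H) := by
    rw [← map_mulVec_add_multivariateGaussian hS (posDef_noiseCov b hσ H).posSemidef, ← hμ,
      ← hprod, Measure.map_map (by fun_prop) (by fun_prop)]
    congr 1
    funext ω
    simp only [hdest, Function.comp_apply]
  rw [mutualInfo, hjoint, hx, hy]
  exact klDiv_gaussian_channel hS (posDef_noiseCov b hσ H) T

/-- The expected relay power as a trace. -/
theorem integral_relaySent_eq (a σ : ℝ) {S : Matrix (Fin n) (Fin n) ℝ} (hS : S.PosSemidef)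
    (H : Matrix (Fin n) (Fin n) ℝ) :
    ∫ ω, ‖relaySent a H ω‖ ^ 2 ∂(blockLaw σ S) =
      (H * (a ^ 2 • S + σ ^ 2 • 1) * Hᵀ).trace := by
  have hcov : (a ^ 2 • S + σ ^ 2 • (1 : Matrix (Fin n) (Fin n) ℝ)).PosSemidef :=
    (hS.smul (sq_nonneg a)).add (posSemidef_sq_smul_one σ)
  set ν : Measure (Block n) :=
    multivariateGaussian 0 (σ ^ 2 • (1 : Matrix (Fin n) (Fin n) ℝ)) with hν
  have hproj : (blockLaw σ S).map (fun ω => (ω.1, ω.2.1)) =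
      (multivariateGaussian 0 S).prod ν := by
    have h3 := Measure.map_prod_map (multivariateGaussian 0 S) (ν.prod ν) (f := id)
      (g := Prod.fst) measurable_id measurable_fst
    rw [Measure.map_id, Measure.map_fst_prod] at h3
    simp only [measure_univ, one_smul] at h3
    rw [h3]; rfl
  have hlaw : (blockLaw σ S).map (relaySent a H) =
      multivariateGaussian 0 (H * (a ^ 2 • S + σ ^ 2 • 1) * Hᵀ) := by
    rw [← map_toEuclideanCLM_multivariateGaussian hcov]
    have h5 : a ^ 2 • S + σ ^ 2 • (1 : Matrix (Fin n) (Fin n) ℝ) =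
        (a • 1) * S * (a • (1 : Matrix (Fin n) (Fin n) ℝ))ᵀ + σ ^ 2 • 1 := by
      rw [transpose_smul, transpose_one, Matrix.smul_mul, one_mul, Matrix.mul_smul, mul_one,
        smul_smul, sq]
    rw [h5, ← map_mulVec_add_multivariateGaussian hS (posSemidef_sq_smul_one σ), ← hν, ← hproj,
      Measure.map_map (by fun_prop) (by fun_prop), Measure.map_map (by fun_prop) (by fun_prop)]
    congr 1
    funext ω
    simp only [relaySent, relayReceived, sourceSent, Function.comp_apply, toEuclideanCLM_smul_one]
  rw [← integral_norm_sq_multivariateGaussian (posSemidef_mul_mul_transpose hcov H), ← hlaw,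
    integral_map _ (by fun_prop)]
  unfold relaySent relayReceived sourceSent
  fun_prop

end MutualInformation

/-! ### Complexification and the upper bound at each block length. -/

variable {n : ℕ}

/-- Complexification of a real matrix. -/
abbrev cmap {m n : Type*} (S : Matrix m n ℝ) : Matrix m n ℂ := S.map Complex.ofRealHom

lemma cmap_conjTranspose (S : Matrix (Fin n) (Fin n) ℝ) : (cmap S)ᴴ = cmap Sᵀ := by
  ext i j; simp

lemma cmap_det_re (S : Matrix (Fin n) (Fin n) ℝ) : (cmap S).det.re = S.det := by
  have : (cmap S).det = ((S.det : ℝ) : ℂ) := (Complex.ofRealHom.map_det S).symm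
  rw [this, Complex.ofReal_re]

lemma cmap_trace_re (S : Matrix (Fin n) (Fin n) ℝ) : (cmap S).trace.re = S.trace := by
  simp [Matrix.trace]

lemma cmap_mul (S T : Matrix (Fin n) (Fin n) ℝ) : cmap (S * T) = cmap S * cmap T :=
  Matrix.map_mul

lemma cmap_add (S T : Matrix (Fin n) (Fin n) ℝ) : cmap (S + T) = cmap S + cmap T :=
  Matrix.map_add _ (fun x y => map_add _ x y) S T

lemma cmap_one : cmap (1 : Matrix (Fin n) (Fin n) ℝ) = 1 :=
  Matrix.map_one _ (map_zero _) (map_one _)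

lemma cmap_smul (s : ℝ) (S : Matrix (Fin n) (Fin n) ℝ) : cmap (s • S) = (s : ℂ) • cmap S := by
  ext i j; simp

lemma posSemidef_cmap {S : Matrix (Fin n) (Fin n) ℝ} (hS : S.PosSemidef) :
    (cmap S).PosSemidef := by
  obtain ⟨B, hB⟩ : ∃ B : Matrix (Fin n) (Fin n) ℝ, S = Bᴴ * B := by
    open scoped MatrixOrder in
    exact CStarAlgebra.nonneg_iff_eq_star_mul_self.1 hS.nonneg
  rw [hB, cmap_mul, conjTranspose_eq_transpose_of_trivial, ← cmap_conjTranspose]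
  exact posSemidef_conjTranspose_mul_self _

lemma posSemidef_of_cmap {S : Matrix (Fin n) (Fin n) ℝ} (hS : (cmap S).PosSemidef) :
    S.PosSemidef := by
  refine PosSemidef.of_dotProduct_mulVec_nonneg ?_ fun x => ?_
  · have h := hS.1
    rw [IsHermitian, cmap_conjTranspose] at h
    ext i j
    have := congrFun (congrFun h i) j
    simpa using this
  · have h := hS.dotProduct_mulVec_nonneg (fun i => (x i : ℂ))
    have h2 : star (fun i => (x i : ℂ)) ⬝ᵥ (cmap S *ᵥ fun i => (x i : ℂ)) =
        ((star x ⬝ᵥ (S *ᵥ x) : ℝ) : ℂ) := by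
      simp [dotProduct, mulVec]
    rw [h2] at h
    exact_mod_cast h

/-- For real matrices the log-determinant rate is the normalised mutual information. -/
lemma logDetRate_cmap (a b σ : ℝ) (H S : Matrix (Fin n) (Fin n) ℝ) :
    logDetRate a b σ (cmap H) (cmap S) = 1 / n * (1 / 2 *
      Real.log (((1 + (a * b) • H) * S * (1 + (a * b) • H)ᵀ + noiseCov b σ H).det /
        (noiseCov b σ H).det)) := by
  have hA : (1 : Matrix (Fin n) (Fin n) ℂ) + ((a * b : ℝ) : ℂ) • cmap H =
      cmap (1 + (a * b) • H) := by rw [cmap_add, cmap_one, cmap_smul]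
  have hN : ((σ ^ 2 : ℝ) : ℂ) • (1 + ((b ^ 2 : ℝ) : ℂ) • (cmap H * (cmap H)ᴴ)) =
      cmap (noiseCov b σ H) := by
    rw [noiseCov, cmap_smul, cmap_add, cmap_one, cmap_smul, cmap_mul, cmap_conjTranspose]
  simp only [logDetRate]
  rw [hA, hN, cmap_conjTranspose, ← cmap_mul, ← cmap_mul, ← cmap_add, cmap_det_re, cmap_det_re]
  have : (1 : ℝ) / (2 * n) = 1 / n * (1 / 2) := by
    rw [one_div, one_div, one_div, mul_inv, mul_comm]
  rw [this]; ring

lemma mutualInfo_div_eq_logDetRate (a b : ℝ) {σ : ℝ} (hσ : 0 < σ) (hn : 0 < n)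
    {S : Matrix (Fin n) (Fin n) ℝ} (hS : S.PosSemidef) (H : Matrix (Fin n) (Fin n) ℝ) :
    mutualInfo (blockLaw σ S) sourceSent (destReceived a b H) / n =
      ENNReal.ofReal (logDetRate a b σ (cmap H) (cmap S)) := by
  have hn' : (0 : ℝ) < n := by exact_mod_cast hn
  rw [mutualInfo_eq a b hσ hS H, logDetRate_cmap, one_div_mul_eq_div (n : ℝ),
    ENNReal.ofReal_div_of_pos hn', ENNReal.ofReal_natCast]

lemma cmap_toeplitz (c : ℤ → ℝ) (n : ℕ) : cmap (toeplitz c n) = toeplitz (fun k => (c k : ℂ)) n :=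
  rfl

lemma trace_relay_cmap (a σ : ℝ) (H S : Matrix (Fin n) (Fin n) ℝ) :
    (cmap H * (((a ^ 2 : ℝ) : ℂ) • cmap S + ((σ ^ 2 : ℝ) : ℂ) • 1) * (cmap H)ᴴ).trace.re =
      (H * (a ^ 2 • S + σ ^ 2 • 1) * Hᵀ).trace := by
  rw [← cmap_trace_re, cmap_mul, cmap_mul, cmap_add, cmap_smul, cmap_smul, cmap_one,
    cmap_conjTranspose]

lemma IsAdmissible.complex {a σ P γ : ℝ} {h r : ℤ → ℝ} (hh : IsAdmissible a σ P γ n h r) :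
    IsAdmissibleComplex a σ P γ n (fun k => (h k : ℂ)) (fun k => (r k : ℂ)) where
  stable := by simpa [IsStable] using hh.stable
  stationary := fun N => by
    rw [← cmap_toeplitz]; exact posSemidef_cmap (hh.stationary N)
  source_power := by
    rw [← cmap_toeplitz, cmap_trace_re]; exact hh.source_power
  relay_power := by
    rw [← cmap_toeplitz, ← cmap_toeplitz, trace_relay_cmap,
      ← integral_relaySent_eq a σ (hh.stationary n)]
    exact hh.relay_power

lemma blockCapacity_le_blockCapacityComplex (a b : ℝ) {σ : ℝ} (hσ : 0 < σ) (P γ : ℝ)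
    (hn : 0 < n) : blockCapacity a b σ P γ n ≤ blockCapacityComplex a b σ P γ n := by
  refine iSup_le fun h => iSup_le fun r => iSup_le fun hh => ?_
  rw [mutualInfo_div_eq_logDetRate a b hσ hn (hh.stationary n), cmap_toeplitz, cmap_toeplitz]
  exact le_iSup_of_le _ (le_iSup_of_le _ (le_iSup_of_le hh.complex le_rfl))

/-- A Lagrangian bound for single modes bounds the rate of every relay matrix. -/
lemma logDetRate_le_of_multipliers {a b σ P Q C μ ν : ℝ} (hσ : 0 < σ) (hμ : 0 < μ) (hν : 0 ≤ ν)
    (hC : 0 ≤ C)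
    (hL : ∀ (x : ℝ) (z : ℂ), 0 ≤ x → gaussCap (x / σ ^ 2 * modeGain a b z) ≤
      C + μ * (x - P) + ν * (‖z‖ ^ 2 * (a ^ 2 * x + σ ^ 2) - Q))
    (H : Matrix (Fin n) (Fin n) ℂ) {S : Matrix (Fin n) (Fin n) ℂ} (hS : S.PosSemidef)
    (hP : S.trace.re ≤ n * P)
    (hQ : (H * (((a ^ 2 : ℝ) : ℂ) • S + ((σ ^ 2 : ℝ) : ℂ) • 1) * Hᴴ).trace.re ≤ n * Q) :
    logDetRate a b σ H S ≤ C := by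
  rcases Nat.eq_zero_or_pos n with rfl | hn
  · simpa [logDetRate] using hC
  have hn' : (0 : ℝ) < n := by exact_mod_cast hn
  have hσ2 : 0 < σ ^ 2 := by positivity
  have hσc : ((σ ^ 2 : ℝ) : ℂ) ≠ 0 := by exact_mod_cast hσ2.ne'
  set S' : Matrix (Fin n) (Fin n) ℂ := (((σ ^ 2)⁻¹ : ℝ) : ℂ) • S with hS'
  have hS'psd : S'.PosSemidef := hS.smul (by exact_mod_cast (inv_pos.2 hσ2).le)
  have hSS' : S = ((σ ^ 2 : ℝ) : ℂ) • S' := by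
    rw [hS', smul_smul, ← Complex.ofReal_mul, mul_inv_cancel₀ hσ2.ne', Complex.ofReal_one, one_smul]
  -- Dividing S by σ² normalises the noise, whence the factors σ²; the factors 2 undo the ½ in
  -- `gaussCap`.
  have key := log_det_ratio_le_of_scalar_bound (n := n) (a := a) (b := b) (μ := 2 * μ * σ ^ 2)
    (ν := 2 * ν * σ ^ 2) (L := 2 * (C - μ * P - ν * Q)) (by positivity) (by positivity) (by
      intro l p hl hp
      have h1 := hL (σ ^ 2 * p) ((alignSign a b * l : ℝ) : ℂ) (by positivity)
      rw [mul_div_cancel_left₀ _ hσ2.ne', modeGain_alignSign a b hl, norm_alignSign_mul a b hl,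
        gaussCap] at h1
      nlinarith) H hS'psd
  set A : Matrix (Fin n) (Fin n) ℂ := 1 + ((a * b : ℝ) : ℂ) • H with hA
  set N : Matrix (Fin n) (Fin n) ℂ := 1 + ((b ^ 2 : ℝ) : ℂ) • (H * Hᴴ) with hN
  have hdet : ∀ X : Matrix (Fin n) (Fin n) ℂ,
      (((σ ^ 2 : ℝ) : ℂ) • X).det.re = (σ ^ 2) ^ n * X.det.re := by
    intro X
    rw [det_smul, Fintype.card_fin, ← Complex.ofReal_pow, Complex.re_ofReal_mul]
  have hnum : A * S * Aᴴ + ((σ ^ 2 : ℝ) : ℂ) • N = ((σ ^ 2 : ℝ) : ℂ) • (A * S' * Aᴴ + N) := by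
    rw [hSS', Matrix.mul_smul, Matrix.smul_mul, ← smul_add]
  have hratio : logDetRate a b σ H S =
      1 / (2 * n) * Real.log ((A * S' * Aᴴ + N).det.re / N.det.re) := by
    simp only [logDetRate]
    rw [← hA, ← hN, hnum, hdet, hdet, mul_div_mul_left _ _ (by positivity)]
  have htr : S.trace.re = σ ^ 2 * S'.trace.re := by
    rw [hSS', trace_smul, smul_eq_mul, Complex.re_ofReal_mul]
  have hrel : (H * (((a ^ 2 : ℝ) : ℂ) • S + ((σ ^ 2 : ℝ) : ℂ) • 1) * Hᴴ).trace.re =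
      σ ^ 2 * (H * (((a ^ 2 : ℝ) : ℂ) • S' + 1) * Hᴴ).trace.re := by
    rw [hSS', smul_comm, ← smul_add, Matrix.mul_smul, Matrix.smul_mul, trace_smul, smul_eq_mul,
      Complex.re_ofReal_mul]
  rw [htr] at hP
  rw [hrel] at hQ
  rw [hratio, one_div_mul_eq_div, div_le_iff₀ (by positivity)]
  refine key.trans ?_
  have h1 := mul_le_mul_of_nonneg_left hP (by positivity : 0 ≤ 2 * μ)
  have h2 := mul_le_mul_of_nonneg_left hQ (by positivity : 0 ≤ 2 * ν)
  linarith

lemma blockCapacityComplex_le_of_multipliers {a b σ P γ C μ ν : ℝ} (hσ : 0 < σ) (hμ : 0 < μ)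
    (hν : 0 ≤ ν) (hC : 0 ≤ C)
    (hL : ∀ (x : ℝ) (z : ℂ), 0 ≤ x → gaussCap (x / σ ^ 2 * modeGain a b z) ≤
      C + μ * (x - P) + ν * (‖z‖ ^ 2 * (a ^ 2 * x + σ ^ 2) - γ * P)) (n : ℕ) :
    blockCapacityComplex a b σ P γ n ≤ ENNReal.ofReal C := by
  refine iSup_le fun h => iSup_le fun r => iSup_le fun hh => ENNReal.ofReal_le_ofReal ?_
  exact logDetRate_le_of_multipliers hσ hμ hν hC hL _ (hh.stationary n) hh.source_power
    hh.relay_power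

/-! ### Periodic sequences, Fourier diagonalisation and achievability. -/

/-- The primitive root of unity `exp (2 π i / n)`. -/
def rootUnity (n : ℕ) : ℂ := Complex.exp (2 * Real.pi * Complex.I / n)

lemma rootUnity_ne_zero (n : ℕ) : rootUnity n ≠ 0 := Complex.exp_ne_zero _

lemma isPrimitiveRoot_rootUnity {n : ℕ} (hn : n ≠ 0) : IsPrimitiveRoot (rootUnity n) n :=
  Complex.isPrimitiveRoot_exp n hn

lemma star_rootUnity {n : ℕ} (hn : n ≠ 0) : star (rootUnity n) = (rootUnity n)⁻¹ := by
  have h := (isPrimitiveRoot_rootUnity hn).norm'_eq_one hn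
  rw [Complex.inv_def, Complex.normSq_eq_norm_sq, h]
  simp

lemma star_rootUnity_zpow {n : ℕ} (hn : n ≠ 0) (m : ℤ) :
    star (rootUnity n ^ m) = rootUnity n ^ (-m) := by
  rw [star_zpow₀, star_rootUnity hn, _root_.inv_zpow']

/-- Rectangular Fourier matrix with `N` rows and `n` columns. -/
def fourierMatrix (N n : ℕ) : Matrix (Fin N) (Fin n) ℂ :=
  Matrix.of fun i k => ((√n : ℝ) : ℂ)⁻¹ * rootUnity n ^ ((k : ℤ) * (i : ℤ))

/-- The `n`-periodic sequence with discrete Fourier coefficients `lam`. -/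
def circSeq {n : ℕ} (lam : Fin n → ℝ) (m : ℤ) : ℝ :=
  (∑ k : Fin n, (lam k : ℂ) * rootUnity n ^ ((k : ℤ) * m)).re / n

lemma sqrt_natCast_inv_mul_self (n : ℕ) :
    ((√n : ℝ) : ℂ)⁻¹ * ((√n : ℝ) : ℂ)⁻¹ = (n : ℂ)⁻¹ := by
  rw [← mul_inv, ← Complex.ofReal_mul, Real.mul_self_sqrt (by positivity)]; simp

lemma fourierMatrix_conjTranspose_mul_self {n : ℕ} (hn : n ≠ 0) :
    (fourierMatrix n n)ᴴ * fourierMatrix n n = 1 := by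
  have hnc : (n : ℂ) ≠ 0 := by exact_mod_cast hn
  have hζ := isPrimitiveRoot_rootUnity hn
  ext k l
  have h1 : ((fourierMatrix n n)ᴴ * fourierMatrix n n) k l =
      (n : ℂ)⁻¹ * ∑ i ∈ Finset.range n, (rootUnity n ^ ((l : ℤ) - (k : ℤ))) ^ i := by
    rw [mul_apply, Finset.sum_range, Finset.mul_sum]
    refine Finset.sum_congr rfl fun i _ => ?_
    rw [conjTranspose_apply, fourierMatrix, of_apply, of_apply, star_mul', star_rootUnity_zpow hn,
      star_inv₀, RCLike.star_def, Complex.conj_ofReal, mul_mul_mul_comm, sqrt_natCast_inv_mul_self,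
      ← zpow_add₀ (rootUnity_ne_zero n), ← zpow_natCast, ← _root_.zpow_mul]
    congr 2; ring
  rw [h1]
  by_cases hkl : k = l
  · subst hkl
    simp [hnc]
  · rw [one_apply_ne hkl]
    have hw1 : rootUnity n ^ ((l : ℤ) - (k : ℤ)) ≠ 1 := by
      intro h
      have hdvd := (hζ.zpow_eq_one_iff_dvd _).1 h
      have := Int.eq_zero_of_abs_lt_dvd hdvd (by rw [abs_lt]; omega)
      exact hkl (Fin.ext (by omega))
    have hwn : (rootUnity n ^ ((l : ℤ) - (k : ℤ))) ^ n = 1 := by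
      rw [← zpow_natCast, ← _root_.zpow_mul, mul_comm, _root_.zpow_mul, zpow_natCast, hζ.pow_eq_one, _root_.one_zpow]
    rw [geom_sum_eq hw1, hwn, sub_self, zero_div, mul_zero]

/-- Symmetry of a sequence indexed by the frequencies `0, …, n - 1`. -/
def IsEvenSeq {n : ℕ} {R : Type*} (lam : Fin n → R) : Prop :=
  ∀ k l : Fin n, (k : ℕ) + l = n → lam k = lam l

lemma ofReal_circSeq {n : ℕ} (hn : n ≠ 0) {lam : Fin n → ℝ} (hlam : IsEvenSeq lam) (m : ℤ) :
    ((circSeq lam m : ℝ) : ℂ) =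
      (n : ℂ)⁻¹ * ∑ k : Fin n, (lam k : ℂ) * rootUnity n ^ ((k : ℤ) * m) := by
  have : NeZero n := ⟨hn⟩
  set D := ∑ k : Fin n, (lam k : ℂ) * rootUnity n ^ ((k : ℤ) * m) with hD
  -- Conjugation sends frequency k to -k, which evenness undoes. So the sum is real and the real
  -- part in `circSeq` loses nothing.
  have hstar : star D = D := by
    rw [hD, star_sum]
    rw [← Equiv.sum_comp (Equiv.neg (Fin n))]
    refine Finset.sum_congr rfl fun k _ => ?_
    rw [star_mul', star_rootUnity_zpow hn, RCLike.star_def, Complex.conj_ofReal, Equiv.neg_apply]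
    by_cases hk : k = 0
    · subst hk; simp
    · have hval : ((-k : Fin n) : ℕ) = n - k := by
        rw [Fin.val_neg, if_neg hk]
      have hkn := k.2
      rw [hlam (-k) k (by rw [hval]; omega), hval]
      congr 1
      have : -(((n - (k : ℕ) : ℕ) : ℤ) * m) = (k : ℤ) * m + (n : ℤ) * (-m) := by
        push_cast [hkn.le]; ring
      rw [this, zpow_add₀ (rootUnity_ne_zero n), _root_.zpow_mul _ (n : ℤ), zpow_natCast,
        (isPrimitiveRoot_rootUnity hn).pow_eq_one, _root_.one_zpow, mul_one]
  have hre : ((D.re : ℝ) : ℂ) = D := Complex.conj_eq_iff_re.1 hstar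
  rw [circSeq, ← hD, Complex.ofReal_div, hre, Complex.ofReal_natCast, div_eq_inv_mul]

/-- Toeplitz sections of a periodic sequence in terms of its Fourier coefficients. -/
lemma toeplitz_circSeq {n : ℕ} (hn : n ≠ 0) {lam : Fin n → ℝ} (hlam : IsEvenSeq lam) (N : ℕ) :
    cmap (toeplitz (circSeq lam) N) =
      fourierMatrix N n * diagonal (fun k => (lam k : ℂ)) * (fourierMatrix N n)ᴴ := by
  ext i j
  change ((circSeq lam ((i : ℤ) - (j : ℤ)) : ℝ) : ℂ) = _
  rw [ofReal_circSeq hn hlam, mul_apply,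
    Finset.mul_sum]
  refine Finset.sum_congr rfl fun k _ => ?_
  rw [mul_diagonal, conjTranspose_apply, fourierMatrix, of_apply, of_apply, star_mul',
    star_rootUnity_zpow hn, star_inv₀, RCLike.star_def, Complex.conj_ofReal,
    ← sqrt_natCast_inv_mul_self, mul_sub, sub_eq_add_neg, zpow_add₀ (rootUnity_ne_zero n)]
  ring

/-- The rectangular Fourier matrix treats all section sizes N at once: each section is F diag(p) Fᴴ
with p ≥ 0. -/
lemma isAutocovariance_circSeq {n : ℕ} (hn : n ≠ 0) {p : Fin n → ℝ} (hp : IsEvenSeq p)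
    (hp0 : ∀ k, 0 ≤ p k) : IsAutocovariance (circSeq p) := by
  intro N
  apply posSemidef_of_cmap
  rw [toeplitz_circSeq hn hp]
  refine PosSemidef.mul_mul_conjTranspose_same (PosSemidef.diagonal fun k => ?_) _
  simpa using hp0 k

/-- The truncation of a sequence to `|m| < n`. -/
def truncSeq (n : ℕ) (c : ℤ → ℝ) (m : ℤ) : ℝ := if |m| < n then c m else 0

lemma isStable_truncSeq (n : ℕ) (c : ℤ → ℝ) : IsStable (truncSeq n c) := by
  refine summable_of_ne_finset_zero (s := Finset.Ioo (-(n : ℤ)) n) fun m hm => ?_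
  rw [truncSeq, if_neg, norm_zero]
  rwa [Finset.mem_Ioo, ← abs_lt] at hm

/-- Indices of the section differ by less than n, so a periodic filter can be made stable without
changing its action on the block. -/
lemma toeplitz_truncSeq (n : ℕ) (c : ℤ → ℝ) : toeplitz (truncSeq n c) n = toeplitz c n := by
  ext i j
  rw [toeplitz, toeplitz, of_apply, of_apply, truncSeq, if_pos]
  rw [abs_lt]; omega

section Diagonalised

variable {n : ℕ} {U : Matrix (Fin n) (Fin n) ℂ}

lemma conj_diagonal_mul (hU : Uᴴ * U = 1) (d e : Fin n → ℂ) :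
    (U * diagonal d * Uᴴ) * (U * diagonal e * Uᴴ) = U * diagonal (fun k => d k * e k) * Uᴴ := by
  calc _ = U * diagonal d * (Uᴴ * U) * diagonal e * Uᴴ := by simp only [Matrix.mul_assoc]
    _ = _ := by rw [hU, mul_one, Matrix.mul_assoc U, diagonal_mul_diagonal]

lemma conj_diagonal_add (d e : Fin n → ℂ) :
    U * diagonal d * Uᴴ + U * diagonal e * Uᴴ = U * diagonal (fun k => d k + e k) * Uᴴ := by
  rw [← add_mul, ← mul_add, diagonal_add]

lemma conj_diagonal_smul (s : ℂ) (d : Fin n → ℂ) :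
    s • (U * diagonal d * Uᴴ) = U * diagonal (fun k => s * d k) * Uᴴ := by
  rw [← Matrix.smul_mul, ← Matrix.mul_smul, ← diagonal_smul]; rfl

lemma conj_diagonal_one (hU : Uᴴ * U = 1) : U * diagonal (fun _ => (1 : ℂ)) * Uᴴ = 1 := by
  rw [diagonal_one, mul_one, mul_eq_one_comm.1 hU]

lemma conj_diagonal_conjTranspose (d : Fin n → ℂ) :
    (U * diagonal d * Uᴴ)ᴴ = U * diagonal (fun k => star (d k)) * Uᴴ := by
  rw [conjTranspose_mul, conjTranspose_mul, conjTranspose_conjTranspose, diagonal_conjTranspose,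
    Matrix.mul_assoc]; rfl

lemma conj_diagonal_det (hU : Uᴴ * U = 1) (d : Fin n → ℂ) :
    (U * diagonal d * Uᴴ).det = ∏ k, d k := by
  rw [det_mul_right_comm, mul_eq_one_comm.1 hU, one_mul, det_diagonal]

lemma conj_diagonal_trace (hU : Uᴴ * U = 1) (d : Fin n → ℂ) :
    (U * diagonal d * Uᴴ).trace = ∑ k, d k := by
  rw [trace_mul_cycle, hU, one_mul, trace_diagonal]

/-- The rate of commuting relay and covariance matrices. -/
lemma logDetRate_conj_diagonal (hU : Uᴴ * U = 1) (a b : ℝ) {σ : ℝ} (hσ : 0 < σ)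
    (lam : Fin n → ℝ) {p : Fin n → ℝ} (hp : ∀ k, 0 ≤ p k) :
    logDetRate a b σ (U * diagonal (fun k => (lam k : ℂ)) * Uᴴ)
        (U * diagonal (fun k => (p k : ℂ)) * Uᴴ) =
      1 / n * ∑ k, gaussCap (p k / σ ^ 2 * modeGain a b (lam k)) := by
  have h1 : (1 : Matrix (Fin n) (Fin n) ℂ) = U * diagonal (fun _ => (1 : ℂ)) * Uᴴ :=
    (conj_diagonal_one hU).symm
  have hN0 : ∀ k, 0 < σ ^ 2 * (1 + b ^ 2 * lam k ^ 2) := fun k => by positivity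
  have hX0 : ∀ k, 0 < (1 + a * b * lam k) ^ 2 * p k + σ ^ 2 * (1 + b ^ 2 * lam k ^ 2) := fun k =>
    add_pos_of_nonneg_of_pos (mul_nonneg (sq_nonneg _) (hp k)) (hN0 k)
  simp only [logDetRate]
  rw [h1]
  simp only [conj_diagonal_smul, conj_diagonal_add, conj_diagonal_conjTranspose,
    conj_diagonal_mul hU, conj_diagonal_det hU]
  have hN : (∏ k, ((σ ^ 2 : ℝ) : ℂ) * (1 + ((b ^ 2 : ℝ) : ℂ) * ((lam k : ℂ) * star (lam k : ℂ)))) =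
      ((∏ k, σ ^ 2 * (1 + b ^ 2 * lam k ^ 2) : ℝ) : ℂ) := by
    push_cast
    refine Finset.prod_congr rfl fun k _ => ?_
    rw [RCLike.star_def, Complex.conj_ofReal]; ring
  have hX : (∏ k, ((1 + ((a * b : ℝ) : ℂ) * (lam k : ℂ)) * (p k : ℂ) *
      star (1 + ((a * b : ℝ) : ℂ) * (lam k : ℂ)) +
        ((σ ^ 2 : ℝ) : ℂ) * (1 + ((b ^ 2 : ℝ) : ℂ) * ((lam k : ℂ) * star (lam k : ℂ))))) =
      ((∏ k, ((1 + a * b * lam k) ^ 2 * p k + σ ^ 2 * (1 + b ^ 2 * lam k ^ 2)) : ℝ) : ℂ) := by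
    push_cast
    refine Finset.prod_congr rfl fun k _ => ?_
    simp only [star_add, star_mul', star_one, RCLike.star_def, Complex.conj_ofReal]
    ring
  rw [hN, hX, Complex.ofReal_re, Complex.ofReal_re, ← Finset.prod_div_distrib,
    Real.log_prod (fun k _ => (div_pos (hX0 k) (hN0 k)).ne'), Finset.mul_sum, Finset.mul_sum]
  refine Finset.sum_congr rfl fun k _ => ?_
  rw [gaussCap, modeGain]
  have h2 : ‖(1 : ℂ) + (a : ℂ) * b * (lam k : ℂ)‖ ^ 2 = (1 + a * b * lam k) ^ 2 := by
    have : (1 : ℂ) + (a : ℂ) * b * (lam k : ℂ) = ((1 + a * b * lam k : ℝ) : ℂ) := by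
      push_cast; ring
    rw [this, Complex.norm_real, Real.norm_eq_abs, sq_abs]
  have h3 : ‖((lam k : ℝ) : ℂ)‖ ^ 2 = lam k ^ 2 := by
    rw [Complex.norm_real, Real.norm_eq_abs, sq_abs]
  have h4 : ((1 + a * b * lam k) ^ 2 * p k + σ ^ 2 * (1 + b ^ 2 * lam k ^ 2)) /
      (σ ^ 2 * (1 + b ^ 2 * lam k ^ 2)) =
      1 + p k / σ ^ 2 * ((1 + a * b * lam k) ^ 2 / (1 + b ^ 2 * lam k ^ 2)) := by
    have := (hN0 k).ne'
    field_simp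
    ring
  rw [h2, h3, h4, one_div, mul_inv]
  ring

lemma trace_relay_conj_diagonal (hU : Uᴴ * U = 1) (a σ : ℝ) (lam p : Fin n → ℝ) :
    ((U * diagonal (fun k => (lam k : ℂ)) * Uᴴ) *
      (((a ^ 2 : ℝ) : ℂ) • (U * diagonal (fun k => (p k : ℂ)) * Uᴴ) + ((σ ^ 2 : ℝ) : ℂ) • 1) *
      (U * diagonal (fun k => (lam k : ℂ)) * Uᴴ)ᴴ).trace.re =
      ∑ k, lam k ^ 2 * (a ^ 2 * p k + σ ^ 2) := by
  rw [← conj_diagonal_one hU]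
  simp only [conj_diagonal_smul, conj_diagonal_add, conj_diagonal_conjTranspose,
    conj_diagonal_mul hU, conj_diagonal_trace hU]
  rw [Complex.re_sum]
  refine Finset.sum_congr rfl fun k _ => ?_
  rw [← Complex.ofReal_re (lam k ^ 2 * (a ^ 2 * p k + σ ^ 2))]
  congr 1
  rw [RCLike.star_def, Complex.conj_ofReal]
  push_cast
  ring

end Diagonalised

/-- Every even assignment of relay gains and input powers to the frequencies is achievable. -/
theorem ofReal_sum_le_blockCapacity {n : ℕ} (hn : n ≠ 0) (a b : ℝ) {σ P γ : ℝ} (hσ : 0 < σ)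
    {lam p : Fin n → ℝ} (hlam : IsEvenSeq lam) (hp : IsEvenSeq p) (hp0 : ∀ k, 0 ≤ p k)
    (hsource : ∑ k, p k ≤ n * P)
    (hrelay : ∑ k, lam k ^ 2 * (a ^ 2 * p k + σ ^ 2) ≤ n * (γ * P)) :
    ENNReal.ofReal (1 / n * ∑ k, gaussCap (p k / σ ^ 2 * modeGain a b (lam k))) ≤
      blockCapacity a b σ P γ n := by
  have hU := fourierMatrix_conjTranspose_mul_self hn
  have hH : cmap (toeplitz (truncSeq n (circSeq lam)) n) =
      fourierMatrix n n * diagonal (fun k => (lam k : ℂ)) * (fourierMatrix n n)ᴴ := by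
    rw [toeplitz_truncSeq, toeplitz_circSeq hn hlam]
  have hS := toeplitz_circSeq hn hp n
  have hcov := isAutocovariance_circSeq hn hp hp0
  have hadm : IsAdmissible a σ P γ n (truncSeq n (circSeq lam)) (circSeq p) := by
    refine ⟨isStable_truncSeq n _, hcov, ?_, ?_⟩
    · rw [← cmap_trace_re, hS, conj_diagonal_trace hU, Complex.re_sum]
      simpa using hsource
    · rw [integral_relaySent_eq a σ (hcov n), ← trace_relay_cmap, hH, hS,
        trace_relay_conj_diagonal hU]
      exact hrelay
  have hrate := mutualInfo_div_eq_logDetRate a b hσ (Nat.pos_of_ne_zero hn) (hcov n)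
    (toeplitz (truncSeq n (circSeq lam)) n)
  rw [hH, hS, logDetRate_conj_diagonal hU a b hσ lam hp0] at hrate
  rw [← hrate]
  exact le_iSup_of_le _ (le_iSup_of_le _ (le_iSup_of_le hadm le_rfl))

end

/-! ### Rounding band fractions to symmetric frequency assignments. -/

lemma sum_range_min_eq {Φ : ℕ → ℕ} {n F : ℕ} (hF : 2 * F < n) (h0 : Φ 0 = 0)
    (hbig : ∀ i, F < i → Φ i = 0) :
    ∑ k ∈ Finset.range n, Φ (min k (n - k)) = 2 * ∑ i ∈ Finset.range F, Φ (i + 1) := by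
  have hlow : ∑ k ∈ Finset.Ico 0 (F + 1), Φ (min k (n - k)) = ∑ i ∈ Finset.range F, Φ (i + 1) := by
    rw [← Finset.range_eq_Ico, Finset.sum_range_succ']
    simp only [Nat.zero_min, h0, add_zero]
    refine Finset.sum_congr rfl fun k hk => ?_
    rw [Finset.mem_range] at hk
    rw [min_eq_left (by omega)]
  have hmid : ∑ k ∈ Finset.Ico (F + 1) (n - F), Φ (min k (n - k)) = 0 :=
    Finset.sum_eq_zero fun k hk => hbig _ (by rw [Finset.mem_Ico] at hk; omega)
  have hhigh : ∑ k ∈ Finset.Ico (n - F) n, Φ (min k (n - k)) =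
      ∑ i ∈ Finset.range F, Φ (i + 1) := by
    rw [Finset.sum_Ico_eq_sum_range, show n - (n - F) = F by omega, ← Finset.sum_range_reflect]
    refine Finset.sum_congr rfl fun k hk => ?_
    rw [Finset.mem_range] at hk
    congr 1
    omega
  rw [Finset.range_eq_Ico, ← Finset.sum_Ico_consecutive _ (Nat.zero_le (F + 1)) (by omega),
    ← Finset.sum_Ico_consecutive _ (show F + 1 ≤ n - F by omega) (by omega), hlow, hmid, hhigh]
  ring

/-- Symmetric assignment of the labels `j.succ` to exactly `2 * f j` of `n` frequencies. -/
lemma exists_even_labels {m n : ℕ} (f : Fin m → ℕ) (hf : 2 * ∑ j, f j < n) :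
    ∃ lab : Fin n → Fin (m + 1), IsEvenSeq lab ∧
      ∀ j : Fin m, (Finset.univ.filter fun k => lab k = j.succ).card = 2 * f j := by
  set F := ∑ j, f j with hF
  -- Frequencies k and n - k share the label of min(k, n - k). The values 1, …, F are cut into
  -- consecutive blocks of sizes f j; 0 and the middle get label 0. The test i = 0 is needed because
  -- 0 - 1 = 0 in ℕ.
  set φ : ℕ → Fin (m + 1) := fun i =>
    if h : i - 1 < F then if i = 0 then 0 else (finSigmaFinEquiv.symm ⟨i - 1, h⟩).1.succ else 0
    with hφ
  refine ⟨fun k => φ (min (k : ℕ) (n - k)), fun k l hkl => ?_, fun j => ?_⟩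
  · have h1 : n - (k : ℕ) = l := by omega
    have h2 : n - (l : ℕ) = k := by omega
    simp only [h1, h2, min_comm]
  · set Φ : ℕ → ℕ := fun i => if φ i = j.succ then 1 else 0 with hΦ
    have h0 : Φ 0 = 0 := by
      have hz : φ 0 = 0 := by simp [hφ]
      simp only [hΦ, hz]
      exact if_neg (Fin.succ_ne_zero j).symm
    have hbig : ∀ i, F < i → Φ i = 0 := by
      intro i hi
      have hz : φ i = 0 := by
        simp only [hφ]
        rw [dif_neg (by omega)]
      simp only [hΦ, hz]
      exact if_neg (Fin.succ_ne_zero j).symm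
    have hcount : ∑ i ∈ Finset.range F, Φ (i + 1) = f j := by
      rw [Finset.sum_range]
      have h1 : ∀ x : Fin F, Φ ((x : ℕ) + 1) =
          if (finSigmaFinEquiv.symm x).1 = j then 1 else 0 := by
        intro x
        have hx : φ ((x : ℕ) + 1) = (finSigmaFinEquiv.symm x).1.succ := by
          simp only [hφ]
          rw [dif_pos (by simp), if_neg (Nat.succ_ne_zero _)]
          rfl
        simp only [hΦ, hx, Fin.succ_inj]
      simp only [h1]
      rw [Equiv.sum_comp finSigmaFinEquiv.symm
        (fun s : (i : Fin m) × Fin (f i) => if s.1 = j then 1 else 0), Fintype.sum_sigma,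
        Finset.sum_eq_single j (fun i _ hi => by simp [hi]) (by simp)]
      simp
    rw [Finset.card_filter]
    have := sum_range_min_eq hf h0 hbig
    rw [hcount, Finset.sum_range] at this
    exact this

/-- A choice of modes whose band fractions are multiples of `1 / n` is achieved at block length
`n`. -/
lemma ofReal_rate_le_blockCapacity {m n : ℕ} (hn : n ≠ 0) (a b : ℝ) {σ P γ : ℝ} (hσ : 0 < σ)
    (hP : 0 < P) {lab : Fin n → Fin (m + 1)} (hlab : IsEvenSeq lab) {θ : Fin (m + 1) → ℝ}
    (hθ0 : ∀ j, 0 ≤ θ j) (hθ1 : ∑ j, θ j = 1) (l : Fin m → ℝ) {q : Modes m}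
    (hqτ : ∀ j, q.τ j = ((Finset.univ.filter fun k => lab k = j).card : ℝ) / n)
    (hqθ : q.θ = θ) (hql : ∀ j, q.gain j = (l j : ℂ))
    (hrelay : q.relayPower a σ P ≤ γ * P) :
    ENNReal.ofReal (q.rate a b σ P) ≤ blockCapacity a b σ P γ n := by
  have hn' : (0 : ℝ) < n := by exact_mod_cast Nat.pos_of_ne_zero hn
  set N : Fin (m + 1) → ℝ := fun j => ((Finset.univ.filter fun k => lab k = j).card : ℝ) with hN
  have hN0 : ∀ j, 0 ≤ N j := fun j => Nat.cast_nonneg _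
  have hNτ : ∀ j, q.τ j = N j / n := hqτ
  set L : Fin (m + 1) → ℝ := Fin.cons 0 l with hL
  -- Power per frequency carrying label j. A label without frequencies gets X = 0; its share of
  -- power is lost, but its term in the rate is zero.
  set X : Fin (m + 1) → ℝ := fun j => θ j * P * n / N j with hX
  have hX0 : ∀ j, 0 ≤ X j := fun j =>
    div_nonneg (mul_nonneg (mul_nonneg (hθ0 j) hP.le) hn'.le) (hN0 j)
  have hsum : ∀ f : Fin (m + 1) → ℝ, ∑ k, f (lab k) = ∑ j, N j * f j := by
    intro f
    rw [← Finset.sum_fiberwise (s := Finset.univ) (g := lab)]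
    refine Finset.sum_congr rfl fun j _ => ?_
    rw [Finset.sum_congr rfl (g := fun _ => f j), Finset.sum_const, nsmul_eq_mul]
    intro k hk
    rw [(Finset.mem_filter.1 hk).2]
  have hNX : ∀ j, N j * X j ≤ n * (θ j * P) := by
    intro j
    simp only [hX]
    rcases (hN0 j).eq_or_lt with h | h
    · rw [← h, zero_mul]
      exact mul_nonneg hn'.le (mul_nonneg (hθ0 j) hP.le)
    · rw [mul_div_cancel₀ _ h.ne', mul_comm]
  have hmain := ofReal_sum_le_blockCapacity hn a b (P := P) (γ := γ) hσ
    (lam := fun k => L (lab k)) (p := fun k => X (lab k))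
    (fun k k' h => by simp only [hlab k k' h]) (fun k k' h => by simp only [hlab k k' h])
    (fun k => hX0 _) (by
      rw [hsum X]
      calc ∑ j, N j * X j ≤ ∑ j, n * (θ j * P) := Finset.sum_le_sum fun j _ => hNX j
        _ = n * P := by rw [← Finset.mul_sum, ← Finset.sum_mul, hθ1, one_mul])
    (by
      rw [hsum fun j => L j ^ 2 * (a ^ 2 * X j + σ ^ 2), Fin.sum_univ_succ]
      simp only [hL, Fin.cons_zero, Fin.cons_succ]
      rw [zero_pow two_ne_zero, zero_mul, mul_zero, zero_add]
      refine le_trans ?_ (mul_le_mul_of_nonneg_left hrelay hn'.le)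
      rw [Modes.relayPower, Finset.mul_sum]
      refine Finset.sum_le_sum fun j _ => ?_
      rw [hql, Complex.norm_real, Real.norm_eq_abs, sq_abs, hqθ, hNτ]
      have h1 := mul_le_mul_of_nonneg_left (hNX j.succ) (by positivity : 0 ≤ l j ^ 2 * a ^ 2)
      have h2 : (n : ℝ) * (l j ^ 2 * (a ^ 2 * θ j.succ * P + N j.succ / n * σ ^ 2)) =
          l j ^ 2 * a ^ 2 * (n * (θ j.succ * P)) + l j ^ 2 * (N j.succ * σ ^ 2) := by
        field_simp
      rw [h2]
      linarith)
  refine le_trans (le_of_eq ?_) hmain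
  congr 1
  rw [hsum fun j => gaussCap (X j / σ ^ 2 * modeGain a b ((L j : ℝ) : ℂ)), Modes.rate_eq,
    Finset.mul_sum, Fin.sum_univ_succ (fun j => 1 / (n : ℝ) * (N j *
      gaussCap (X j / σ ^ 2 * modeGain a b ((L j : ℝ) : ℂ))))]
  have hterm : ∀ (j : Fin (m + 1)) (g : ℝ), perspCap (q.τ j) (θ j * P / σ ^ 2 * g) =
      1 / (n : ℝ) * (N j * gaussCap (X j / σ ^ 2 * g)) := by
    intro j g
    rw [perspCap, hNτ, ← mul_assoc, one_div_mul_eq_div]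
    congr 2
    simp only [hX]
    rw [div_div_eq_mul_div]
    ring
  rw [hqθ]
  congr 1
  · rw [← hterm]
    simp [hL, modeGain_zero]
  · refine Finset.sum_congr rfl fun j _ => ?_
    rw [← hterm, hql]
    simp [hL]

/-- The rate of modes with real gains is achieved in the limit. -/
lemma exists_tendsto_le_blockCapacity {m : ℕ} (a b : ℝ) {σ P γ : ℝ} (hσ : 0 < σ) (hP : 0 < P)
    {q : Modes m} (hq : q.IsValid) {l : Fin m → ℝ} (hl : ∀ j, q.gain j = (l j : ℂ))
    (hrelay : q.relayPower a σ P ≤ γ * P) :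
    ∃ R : ℕ → ℝ, Tendsto R atTop (𝓝 (q.rate a b σ P)) ∧
      ∀ n, n ≠ 0 → ENNReal.ofReal (R n) ≤ blockCapacity a b σ P γ n := by
  -- Rounding against n - 1 rather than n makes the inequality strict, so the two mirrored groups of
  -- frequencies avoid each other and frequency 0.
  have hfloor : ∀ n : ℕ, n ≠ 0 →
      2 * ∑ j : Fin m, ⌊q.τ j.succ / 2 * ((n - 1 : ℕ) : ℝ)⌋₊ < n := by
    intro n hn
    have h1 : ((∑ j : Fin m, ⌊q.τ j.succ / 2 * ((n - 1 : ℕ) : ℝ)⌋₊ : ℕ) : ℝ) ≤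
        1 / 2 * ((n - 1 : ℕ) : ℝ) := by
      push_cast
      have h2 : ∑ j : Fin m, q.τ j.succ ≤ 1 := by
        have := hq.sum_τ
        rw [Fin.sum_univ_succ] at this
        linarith [hq.τ_nonneg 0]
      calc ∑ j : Fin m, (⌊q.τ j.succ / 2 * ((n - 1 : ℕ) : ℝ)⌋₊ : ℝ) ≤
          ∑ j : Fin m, q.τ j.succ / 2 * ((n - 1 : ℕ) : ℝ) := Finset.sum_le_sum fun j _ =>
            Nat.floor_le (mul_nonneg (div_nonneg (hq.τ_nonneg _) two_pos.le) (Nat.cast_nonneg _))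
        _ = (∑ j : Fin m, q.τ j.succ) / 2 * ((n - 1 : ℕ) : ℝ) := by
            rw [← Finset.sum_mul, ← Finset.sum_div]
        _ ≤ 1 / 2 * ((n - 1 : ℕ) : ℝ) := by gcongr
    have h3 : ((2 * ∑ j : Fin m, ⌊q.τ j.succ / 2 * ((n - 1 : ℕ) : ℝ)⌋₊ : ℕ) : ℝ) ≤
        ((n - 1 : ℕ) : ℝ) := by
      rw [Nat.cast_mul]; push_cast at h1 ⊢; linarith
    have h4 : 2 * ∑ j : Fin m, ⌊q.τ j.succ / 2 * ((n - 1 : ℕ) : ℝ)⌋₊ ≤ n - 1 := by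
      exact_mod_cast h3
    omega
  set T : ℕ → Fin m → ℝ := fun n j =>
    ((2 * ⌊q.τ j.succ / 2 * ((n - 1 : ℕ) : ℝ)⌋₊ : ℕ) : ℝ) / n with hT
  -- The band lost in rounding goes to mode 0, while θ and the gains stay fixed. Rounding down
  -- cannot raise the relay power.
  set qn : ℕ → Modes m := fun n => ⟨Fin.cons (1 - ∑ j, T n j) (T n), q.θ, q.gain⟩ with hqn
  have hTle : ∀ n j, T n j ≤ q.τ j.succ := by
    intro n j
    simp only [hT]
    have hτ := hq.τ_nonneg j.succ
    refine div_le_of_le_mul₀ (Nat.cast_nonneg _) hτ ?_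
    have h1 := Nat.floor_le (mul_nonneg (div_nonneg hτ two_pos.le)
      (Nat.cast_nonneg (α := ℝ) (n - 1)))
    have h2 : ((n - 1 : ℕ) : ℝ) ≤ n := by exact_mod_cast Nat.sub_le n 1
    push_cast
    nlinarith
  have hTnn : ∀ n j, 0 ≤ T n j := fun n j => by simp only [hT]; positivity
  have hTlim : ∀ j, Tendsto (fun n => T n j) atTop (𝓝 (q.τ j.succ)) := by
    intro j
    have hτ := hq.τ_nonneg j.succ
    have hlow : Tendsto (fun n : ℕ => q.τ j.succ - (q.τ j.succ + 2) / (n : ℝ)) atTop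
        (𝓝 (q.τ j.succ - 0)) :=
      tendsto_const_nhds.sub (tendsto_const_div_atTop_nhds_zero_nat _)
    rw [sub_zero] at hlow
    refine tendsto_of_tendsto_of_tendsto_of_le_of_le' hlow tendsto_const_nhds ?_
      (Eventually.of_forall fun n => hTle n j)
    filter_upwards [eventually_gt_atTop 0] with n hn
    have hn' : (0 : ℝ) < n := by exact_mod_cast hn
    simp only [hT]
    rw [sub_le_iff_le_add, ← add_div, le_div_iff₀ hn']
    have h1 := Nat.lt_floor_add_one (q.τ j.succ / 2 * ((n - 1 : ℕ) : ℝ))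
    have h2 : ((n - 1 : ℕ) : ℝ) = n - 1 := by push_cast [Nat.one_le_iff_ne_zero.2 hn.ne']; ring
    rw [h2] at h1 ⊢
    push_cast
    nlinarith
  refine ⟨fun n => (qn n).rate a b σ P, ?_, ?_⟩
  · simp only [Modes.rate_eq]
    have hθP : ∀ j, 0 ≤ q.θ j * P / σ ^ 2 := fun j =>
      div_nonneg (mul_nonneg (hq.θ_nonneg j) hP.le) (by positivity)
    have hpersp : ∀ {u : ℕ → ℝ} {t x : ℝ}, (∀ n, 0 ≤ u n) → 0 ≤ t → 0 ≤ x →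
        Tendsto u atTop (𝓝 t) → Tendsto (fun n => perspCap (u n) x) atTop (𝓝 (perspCap t x)) := by
      intro u t x hu ht hx hlim
      have h1 := continuousOn_perspCap (t, x) ⟨ht, hx⟩
      refine (h1.tendsto).comp (tendsto_nhdsWithin_iff.2
        ⟨hlim.prodMk_nhds tendsto_const_nhds, Eventually.of_forall fun n => ⟨hu n, hx⟩⟩)
    have hτ0 : q.τ 0 = 1 - ∑ j : Fin m, q.τ j.succ := by
      have := hq.sum_τ
      rw [Fin.sum_univ_succ] at this
      linarith
    refine Tendsto.add ?_ (tendsto_finsetSum _ fun j _ => ?_)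
    · simp only [hqn, Fin.cons_zero]
      refine hpersp (fun n => ?_) (hq.τ_nonneg 0) (hθP 0) ?_
      · have : ∑ j, T n j ≤ ∑ j : Fin m, q.τ j.succ := Finset.sum_le_sum fun j _ => hTle n j
        linarith [hq.τ_nonneg 0]
      · rw [hτ0]
        exact tendsto_const_nhds.sub (tendsto_finsetSum _ fun j _ => hTlim j)
    · simp only [hqn, Fin.cons_succ]
      exact hpersp (fun n => hTnn n j) (hq.τ_nonneg _)
        (mul_nonneg (hθP _) (modeGain_nonneg _ _ _)) (hTlim j)
  · intro n hn
    have hn' : (n : ℝ) ≠ 0 := by exact_mod_cast hn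
    obtain ⟨lab, hlab, hcard⟩ := exists_even_labels _ (hfloor n hn)
    refine ofReal_rate_le_blockCapacity hn a b hσ hP hlab hq.θ_nonneg hq.sum_θ l (q := qn n) ?_ rfl
      hl ?_
    · have hsucc : ∀ j : Fin m, (qn n).τ j.succ =
          ((Finset.univ.filter fun k => lab k = j.succ).card : ℝ) / n := by
        intro j
        rw [hcard j]
        simp only [hqn, Fin.cons_succ, hT]
      refine Fin.cases ?_ hsucc
      have htotal : ∑ j : Fin (m + 1),
          ((Finset.univ.filter fun k => lab k = j).card : ℝ) = n := by
        have h1 := Finset.card_eq_sum_card_fiberwise (s := (Finset.univ : Finset (Fin n)))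
          (t := (Finset.univ : Finset (Fin (m + 1)))) (f := lab) (fun _ _ => Finset.mem_univ _)
        rw [Finset.card_univ, Fintype.card_fin] at h1
        exact_mod_cast h1.symm
      rw [Fin.sum_univ_succ] at htotal
      have h2 : (qn n).τ 0 = 1 - ∑ j : Fin m, (qn n).τ j.succ := by
        simp only [hqn, Fin.cons_zero, Fin.cons_succ]
      rw [h2]
      simp only [hsucc]
      rw [← Finset.sum_div]
      field_simp
      linarith
    · refine le_trans (Finset.sum_le_sum fun j _ => ?_) hrelay
      simp only [hqn, Fin.cons_succ]
      gcongr
      exact hTle n j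

end LTIRelay

end

/-! ### Conclusion. -/

theorem theorem2 (a b σ P γ : ℝ) (hσ : 0 < σ) (hP : 0 < P) (hγ : 0 < γ) :
    ∃ C : ℝ,
      Tendsto (fun n : ℕ => LTIRelay.blockCapacity a b σ P γ n) atTop (𝓝 (ENNReal.ofReal C)) ∧
      Tendsto (fun n : ℕ => LTIRelay.blockCapacityComplex a b σ P γ n) atTop
        (𝓝 (ENNReal.ofReal C)) ∧
      IsGreatest {R : ℝ | ∃ q : LTIRelay.Modes 49, q.IsValid ∧
        q.relayPower a σ P ≤ γ * P ∧ q.rate a b σ P = R} C ∧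
      IsLUB {R : ℝ | ∃ q : LTIRelay.Modes 49, q.IsValid ∧
        q.relayPower a σ P = γ * P ∧ q.rate a b σ P = R} C := by
  have hQ : 0 < γ * P := mul_pos hγ hP
  obtain ⟨q, l, hl, hq, hqpow, hmax⟩ :=
    LTIRelay.Modes.exists_isMax_rate 49 a b σ hP.le hQ.le
  have hhull : ∀ t ∈ convexHull ℝ (LTIRelay.modeTriples a b σ), t.2.1 ≤ P → t.2.2 ≤ γ * P →
      t.1 ≤ q.rate a b σ P := by
    intro t ht htP htQ
    obtain ⟨q', hq', -, -, hpow', hrate'⟩ :=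
      LTIRelay.exists_modes_of_mem_convexHull (m := 48) (by norm_num) hP ht htP
    rw [← hrate']
    exact hmax q' hq' (hpow'.trans_le htQ)
  have hC0 : 0 ≤ q.rate a b σ P :=
    hhull _ (subset_convexHull ℝ _ (LTIRelay.zero_mem_modeTriples a b σ)) hP.le hQ.le
  obtain ⟨μ, ν, hμ, hν, hL⟩ := LTIRelay.exists_multipliers hσ hP hQ hhull
  have hupper := LTIRelay.blockCapacityComplex_le_of_multipliers hσ hμ hν hC0 hL
  obtain ⟨R, hRlim, hRle⟩ := LTIRelay.exists_tendsto_le_blockCapacity a b hσ hP hq hl hqpow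
  have hRlim' : Tendsto (fun n => ENNReal.ofReal (R n)) atTop
      (𝓝 (ENNReal.ofReal (q.rate a b σ P))) := ENNReal.tendsto_ofReal hRlim
  -- Both limits follow by squeezing: R n ≤ real capacity ≤ complex capacity ≤ C, with block length
  -- 0 set aside.
  have hmid : ∀ᶠ n in atTop, LTIRelay.blockCapacity a b σ P γ n ≤
      LTIRelay.blockCapacityComplex a b σ P γ n := by
    filter_upwards [eventually_gt_atTop 0] with n hn
    exact LTIRelay.blockCapacity_le_blockCapacityComplex a b hσ P γ hn
  have hlower : ∀ᶠ n in atTop, ENNReal.ofReal (R n) ≤ LTIRelay.blockCapacity a b σ P γ n := by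
    filter_upwards [eventually_ne_atTop 0] with n hn
    exact hRle n hn
  refine ⟨q.rate a b σ P, ?_, ?_, ⟨⟨q, hq, hqpow, rfl⟩, ?_⟩, ?_, ?_⟩
  · exact tendsto_of_tendsto_of_tendsto_of_le_of_le' hRlim' tendsto_const_nhds hlower
      (hmid.mono fun n hn => hn.trans (hupper n))
  · exact tendsto_of_tendsto_of_tendsto_of_le_of_le' hRlim' tendsto_const_nhds
      (hlower.and hmid |>.mono fun n hn => hn.1.trans hn.2) (Eventually.of_forall hupper)
  · rintro _ ⟨q', hq', hpow', rfl⟩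
    exact hmax q' hq' hpow'
  · rintro _ ⟨q', hq', hpow', rfl⟩
    exact hmax q' hq' hpow'.le
  -- The maximiser may occupy all its modes; replacing its triple by a Carathéodory representation
  -- frees the last one. Spending the spare relay power there costs a factor 1 - ε, and ε tends to
  -- 0.
  · intro B hB
    obtain ⟨p, c, hp, hc, hmem⟩ := hq.mem_convexHull a b (σ := σ) hP.le
    obtain ⟨q', hq', hτ', hθ', hpow', hrate'⟩ :=
      LTIRelay.exists_modes_of_mem_convexHull (m := 48) (by norm_num) hP hmem hp
    have hbound : ∀ ε ∈ Set.Ioo (0 : ℝ) 1, (1 - ε) * q.rate a b σ P ≤ B := by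
      intro ε hε
      obtain ⟨q'', hq'', hpow'', hrate''⟩ := LTIRelay.exists_modes_relayPower_eq (b := b) hσ hP.le
        hq' hτ' hθ' (hpow'.trans_le (hc.trans hqpow)) hε.1 hε.2
      rw [hrate'] at hrate''
      exact hrate''.trans (hB ⟨q'', hq'', hpow'', rfl⟩)
    have hlim : Tendsto (fun ε : ℝ => (1 - ε) * q.rate a b σ P) (𝓝[>] 0)
        (𝓝 ((1 - 0) * q.rate a b σ P)) := by
      refine Tendsto.mono_left ?_ nhdsWithin_le_nhds
      exact Continuous.tendsto (by fun_prop) 0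
    rw [sub_zero, one_mul] at hlim
    exact le_of_tendsto hlim (by
      filter_upwards [Ioo_mem_nhdsGT (zero_lt_one' ℝ)] with ε hε using hbound ε hε)
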